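/- Theorem 1.2. There are a deterministic algorithm on the real RAM (unit-cost arithmetic, square roots and comparisons of real numbers, unit-cost addition, subtraction, comparison and array addressing with natural numbers) and an absolute constant $C>0$ with the following property. Let $d\ge 1$, let $A\in\mathbb{R}^{n\times d}$ have rank $d$, let $P=\{x\in\mathbb{R}^d : -\mathbf{1}_n\le Ax\le \mathbf{1}_n\}$ and let $\epsilon\in(0,1)$. Suppose that $A$ has treewidth $\tau$, i.e. $\tau$ is the treewidth of the graph $G_A$ on the columns $1,\dots,d$ of $A$ in which two distinct columns $i,j$ are adjacent if and only if $A_{k,i}\neq 0$ and $A_{k,j}\neq 0$ for some row $k$. The input of the algorithm consists of $\epsilon$, of $A$ (as the list of nonzero entries of each row), and of any tree decomposition of $G_A$ of width $\tau$ with at most $n$ bags (as the list of elements of each bag and the parent of each node of the tree, rooted and numbered so that parents precede their children). The algorithm halts within time $$C\cdot\max\{\epsilon^{-1}\log(n/d),\,1\}\cdot n\,\max\{\tau,1\}^2 ,$$ and outputs the vector $u=\frac1T\sum_{k=1}^{T}w_k\in\mathbb{R}^n$ for some integer $T\ge 1$ with $\epsilon^{-1}\log(n/d)\le T\le C\max\{\epsilon^{-1}\log(n/d),1\}$,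 where $w_{1,i}=d/n$ and, for $k\ge1$, $w_{k+1,i}=b_{k,i}^\top(B_k^\top B_k)^{-1}b_{k,i}$ is the exact leverage score of the $i$-th row $b_{k,i}^\top$ of $B_k=\sqrt{\mathrm{diag}(w_k)}\,A$ $(1\le i\le n)$. The matrix $A^\top\mathrm{diag}(u)A$ is positive definite, and the ellipsoid $Q=\{x\in\mathbb{R}^d : x^\top A^\top\mathrm{diag}(u)A\,x\le 1\}$ satisfies $$\frac{1}{\sqrt{1+\epsilon}}\,Q\subseteq P\subseteq\sqrt d\,Q .$$ In particular, if $\tau\ge1$ and $\epsilon^{-1}\log(n/d)\ge1$, then the running time is $O(\epsilon^{-1}n\tau^2\log(n/d))$. -/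

import Mathlib

open scoped Matrix Pointwise

/-! ## Tree decompositions and treewidth -/

/-- A tree decomposition of the graph `G`: a (finite, nonempty) tree on the nodes `0, …, m - 1`
together with a family of bags. -/
structure TreeDecomposition {V : Type*} (G : SimpleGraph V) (m : ℕ) where
  tree : SimpleGraph (Fin m)
  isTree : tree.IsTree
  bag : Fin m → Finset V
  /-- Every vertex lies in some bag. -/
  cover : ∀ v, ∃ t, v ∈ bag t
  /-- The nodes whose bags contain a given vertex span a connected subgraph of the tree. -/
  connected : ∀ v, (tree.induce {t | v ∈ bag t}).Connected
  /-- Both ends of every edge lie in a common bag. -/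
  edge : ∀ u v, G.Adj u v → ∃ t, u ∈ bag t ∧ v ∈ bag t

namespace TreeDecomposition

variable {V : Type*} {G : SimpleGraph V} {m : ℕ}

/-- The width `max_t |bag t| - 1`. -/
def width (D : TreeDecomposition G m) : ℕ :=
  Finset.univ.sup fun t => (D.bag t).card - 1

/-- The nodes are numbered from the root `0` downwards: every other node has a neighbour
(its parent) with a smaller number. Every tree has such a numbering. -/
def RootFirst (D : TreeDecomposition G m) : Prop :=
  ∀ t : Fin m, 0 < t.val → ∃ s : Fin m, s < t ∧ D.tree.Adj s t

/-- The neighbour of `t` with a smaller number (`0` for the root itself). -/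
noncomputable def parent (D : TreeDecomposition G m) (t : Fin m) : ℕ :=
  sInf {k | ∃ s : Fin m, s.val = k ∧ s < t ∧ D.tree.Adj s t}

end TreeDecomposition

/-- The treewidth of a graph: the minimum width of its tree decompositions. -/
noncomputable def graphTreewidth {V : Type*} (G : SimpleGraph V) : ℕ :=
  sInf {w | ∃ (m : ℕ) (D : TreeDecomposition G m), D.width = w}

/-- The graph of a matrix: its vertices are the columns, and two distinct columns are adjacent
when some row is nonzero in both of them. -/
def columnGraph {n d : ℕ} (A : Matrix (Fin n) (Fin d) ℝ) : SimpleGraph (Fin d) where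
  Adj i j := i ≠ j ∧ ∃ k, A k i ≠ 0 ∧ A k j ≠ 0
  symm := ⟨fun _ _ h => ⟨h.1.symm, h.2.imp fun _ hk => ⟨hk.2, hk.1⟩⟩⟩
  loopless := ⟨fun _ h => h.1 rfl⟩

/-- The treewidth of a matrix. -/
noncomputable def matrixTreewidth {n d : ℕ} (A : Matrix (Fin n) (Fin d) ℝ) : ℕ :=
  graphTreewidth (columnGraph A)

/-! ## The polytope, ellipsoids, and the fixed-point iteration -/

/-- The centrally symmetric polytope `{x : -1 ≤ A x ≤ 1}`. -/
def polytope {n d : ℕ} (A : Matrix (Fin n) (Fin d) ℝ) : Set (Fin d → ℝ) :=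
  {x | -1 ≤ A *ᵥ x ∧ A *ᵥ x ≤ 1}

/-- The set `{x : xᵀ M x ≤ 1}`, an ellipsoid centred at the origin when `M` is positive
definite. -/
def ellipsoid {d : ℕ} (M : Matrix (Fin d) (Fin d) ℝ) : Set (Fin d → ℝ) :=
  {x | x ⬝ᵥ (M *ᵥ x) ≤ 1}

/-- The leverage score `b_iᵀ (Bᵀ B)⁻¹ b_i` of the `i`-th row `b_i` of `B`. -/
noncomputable def leverageScore {n d : ℕ} (B : Matrix (Fin n) (Fin d) ℝ) (i : Fin n) : ℝ :=
  B i ⬝ᵥ ((Bᵀ * B)⁻¹ *ᵥ B i)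

/-- The fixed-point iteration: the first weight vector is constant equal to `d / n`, and the
next one consists of the leverage scores of `√(diag w) A`. -/
noncomputable def fixedPointIterate {n d : ℕ} (A : Matrix (Fin n) (Fin d) ℝ) :
    ℕ → Fin n → ℝ
  | 0 => fun _ => (d : ℝ) / n
  | k + 1 => leverageScore (Matrix.diagonal (fun i => √(fixedPointIterate A k i)) * A)

/-- The average of the first `T` weight vectors of the fixed-point iteration. -/
noncomputable def averageIterate {n d : ℕ} (A : Matrix (Fin n) (Fin d) ℝ) (T : ℕ) :
    Fin n → ℝ :=
  fun i => (∑ k ∈ Finset.range T, fixedPointIterate A k i) / T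

/-! ## A real RAM

The memory consists of arrays of natural numbers (used for indices) and arrays of real numbers.
Array names are fixed in the program text, entries are addressed by computed pairs of natural
numbers. Natural numbers may be added, subtracted and compared; real numbers may be added,
subtracted, multiplied, divided and compared, and square roots may be taken. There is no rounding
of reals and there are no real constants other than natural numbers. Every operation, memory
access, assignment and branching costs one unit of time. -/

namespace RealRAM

/-- A memory state: `s.nat a i j` and `s.real a i j` are the entries `(i, j)` of the arrays with
name `a`. -/
structure State where
  nat : ℕ → ℕ → ℕ → ℕ
  real : ℕ → ℕ → ℕ → ℝ

/-- Write `v` into entry `(i, j)` of the array of naturals named `a`. -/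
def State.setNat (s : State) (a i j v : ℕ) : State where
  nat a' i' j' := if a' = a ∧ i' = i ∧ j' = j then v else s.nat a' i' j'
  real := s.real

/-- Write `v` into entry `(i, j)` of the array of reals named `a`. -/
noncomputable def State.setReal (s : State) (a i j : ℕ) (v : ℝ) : State where
  nat := s.nat
  real a' i' j' := if a' = a ∧ i' = i ∧ j' = j then v else s.real a' i' j'

/-- Expressions for natural numbers; subtraction is truncated. -/
inductive NExp where
  | lit (c : ℕ)
  | arr (a : ℕ) (i j : NExp)
  | add (x y : NExp)
  | sub (x y : NExp)

/-- Expressions for real numbers. As usual in Mathlib, division by zero and the square root of a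
negative number return zero. -/
inductive RExp where
  | ofNat (x : NExp)
  | arr (a : ℕ) (i j : NExp)
  | add (x y : RExp)
  | sub (x y : RExp)
  | mul (x y : RExp)
  | div (x y : RExp)
  | sqrt (x : RExp)

/-- Tests. -/
inductive BExp where
  | natLt (x y : NExp)
  | realLt (x y : RExp)
  | neg (b : BExp)
  | conj (b c : BExp)

/-- Programs. -/
inductive Cmd where
  | nop
  | setNat (a : ℕ) (i j : NExp) (e : NExp)
  | setReal (a : ℕ) (i j : NExp) (e : RExp)
  | seq (p q : Cmd)
  | ite (b : BExp) (p q : Cmd)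
  | loop (b : BExp) (p : Cmd)

/-- The value of an expression. -/
def NExp.eval (s : State) : NExp → ℕ
  | lit c => c
  | arr a i j => s.nat a (i.eval s) (j.eval s)
  | add x y => x.eval s + y.eval s
  | sub x y => x.eval s - y.eval s

/-- The time needed to evaluate an expression. -/
def NExp.cost : NExp → ℕ
  | lit _ => 1
  | arr _ i j => i.cost + j.cost + 1
  | add x y => x.cost + y.cost + 1
  | sub x y => x.cost + y.cost + 1

/-- The value of an expression. -/
noncomputable def RExp.eval (s : State) : RExp → ℝ
  | ofNat x => (x.eval s : ℝ)
  | arr a i j => s.real a (i.eval s) (j.eval s)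
  | add x y => x.eval s + y.eval s
  | sub x y => x.eval s - y.eval s
  | mul x y => x.eval s * y.eval s
  | div x y => x.eval s / y.eval s
  | sqrt x => √(x.eval s)

/-- The time needed to evaluate an expression. -/
def RExp.cost : RExp → ℕ
  | ofNat x => x.cost + 1
  | arr _ i j => i.cost + j.cost + 1
  | add x y => x.cost + y.cost + 1
  | sub x y => x.cost + y.cost + 1
  | mul x y => x.cost + y.cost + 1
  | div x y => x.cost + y.cost + 1
  | sqrt x => x.cost + 1

/-- The truth value of a test. -/
def BExp.holds (s : State) : BExp → Prop
  | natLt x y => x.eval s < y.eval s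
  | realLt x y => x.eval s < y.eval s
  | neg b => ¬ b.holds s
  | conj b c => b.holds s ∧ c.holds s

/-- The time needed to evaluate a test. -/
def BExp.cost : BExp → ℕ
  | natLt x y => x.cost + y.cost + 1
  | realLt x y => x.cost + y.cost + 1
  | neg b => b.cost + 1
  | conj b c => b.cost + c.cost + 1

/-- `Exec p s s' t`: the program `p`, started in state `s`, halts in state `s'` after exactly `t`
units of time. -/
inductive Exec : Cmd → State → State → ℕ → Prop
  | nop (s : State) : Exec .nop s s 1
  | setNat (a : ℕ) (i j e : NExp) (s : State) :
      Exec (.setNat a i j e) s (s.setNat a (i.eval s) (j.eval s) (e.eval s))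
        (i.cost + j.cost + e.cost + 1)
  | setReal (a : ℕ) (i j : NExp) (e : RExp) (s : State) :
      Exec (.setReal a i j e) s (s.setReal a (i.eval s) (j.eval s) (e.eval s))
        (i.cost + j.cost + e.cost + 1)
  | seq {p q : Cmd} {s s' s'' : State} {t t' : ℕ} :
      Exec p s s' t → Exec q s' s'' t' → Exec (.seq p q) s s'' (t + t')
  | iteTrue {b : BExp} {p q : Cmd} {s s' : State} {t : ℕ} :
      b.holds s → Exec p s s' t → Exec (.ite b p q) s s' (b.cost + t + 1)
  | iteFalse {b : BExp} {p q : Cmd} {s s' : State} {t : ℕ} :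
      ¬ b.holds s → Exec q s s' t → Exec (.ite b p q) s s' (b.cost + t + 1)
  | loopTrue {b : BExp} {p : Cmd} {s s' s'' : State} {t t' : ℕ} :
      b.holds s → Exec p s s' t → Exec (.loop b p) s' s'' t' →
        Exec (.loop b p) s s'' (b.cost + t + t' + 1)
  | loopFalse {b : BExp} {p : Cmd} {s : State} :
      ¬ b.holds s → Exec (.loop b p) s s (b.cost + 1)

/-- Programs are deterministic: the final state and the running time are unique. -/
theorem Exec.unique {p : Cmd} {s s₁ s₂ : State} {t₁ t₂ : ℕ}
    (h₁ : Exec p s s₁ t₁) (h₂ : Exec p s s₂ t₂) : s₁ = s₂ ∧ t₁ = t₂ := by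
  induction h₁ generalizing s₂ t₂ with
  | nop => cases h₂; exact ⟨rfl, rfl⟩
  | setNat => cases h₂; exact ⟨rfl, rfl⟩
  | setReal => cases h₂; exact ⟨rfl, rfl⟩
  | seq _ _ ih ih' =>
    cases h₂ with
    | seq k k' =>
      obtain ⟨rfl, rfl⟩ := ih k
      obtain ⟨rfl, rfl⟩ := ih' k'
      exact ⟨rfl, rfl⟩
  | iteTrue hb _ ih =>
    cases h₂ with
    | iteTrue _ k => obtain ⟨rfl, rfl⟩ := ih k; exact ⟨rfl, rfl⟩
    | iteFalse hb' _ => exact absurd hb hb'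
  | iteFalse hb _ ih =>
    cases h₂ with
    | iteFalse _ k => obtain ⟨rfl, rfl⟩ := ih k; exact ⟨rfl, rfl⟩
    | iteTrue hb' _ => exact absurd hb' hb
  | loopTrue hb _ _ ih ih' =>
    cases h₂ with
    | loopTrue _ k k' =>
      obtain ⟨rfl, rfl⟩ := ih k
      obtain ⟨rfl, rfl⟩ := ih' k'
      exact ⟨rfl, rfl⟩
    | loopFalse hb' => exact absurd hb hb'
  | loopFalse hb =>
    cases h₂ with
    | loopTrue hb' _ _ => exact absurd hb' hb
    | loopFalse _ => exact ⟨rfl, rfl⟩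

end RealRAM

/-! ## Input format -/

open Classical in
/-- The columns in which row `i` of `A` is nonzero, in increasing order. -/
noncomputable def rowSupport {n d : ℕ} (A : Matrix (Fin n) (Fin d) ℝ) (i : Fin n) :
    List (Fin d) :=
  (Finset.univ.filter fun j => A i j ≠ 0).sort (· ≤ ·)

/-- The initial memory for the input `(A, ε, D)`, all indices being counted from `0`:
* naturals 0: the entries `(0,0)`, `(0,1)`, `(0,2)` are `n`, `d` and the number `m` of bags;
* naturals 1: entry `(i,0)` is the number of nonzero entries of row `i` of `A`;
* naturals 2: entry `(i,k)` is the column of the `k`-th nonzero entry of row `i`;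
* naturals 3: entry `(t,0)` is the parent of node `t`;
* naturals 4: entry `(t,0)` is the size of bag `t`;
* naturals 5: entry `(t,k)` is the `k`-th element of bag `t`;
* reals 0: entry `(0,0)` is `ε`;
* reals 1: entry `(i,k)` is the value of the `k`-th nonzero entry of row `i`.

All other memory is zero. -/
noncomputable def inputState {n d m : ℕ} (A : Matrix (Fin n) (Fin d) ℝ) (ε : ℝ)
    (D : TreeDecomposition (columnGraph A) m) : RealRAM.State where
  nat a i k :=
    match a with
    | 0 => if i = 0 then [n, d, m].getD k 0 else 0
    | 1 => if h : i < n ∧ k = 0 then (rowSupport A ⟨i, h.1⟩).length else 0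
    | 2 => if h : i < n then ((rowSupport A ⟨i, h⟩).map Fin.val).getD k 0 else 0
    | 3 => if h : i < m ∧ k = 0 then D.parent ⟨i, h.1⟩ else 0
    | 4 => if h : i < m ∧ k = 0 then (D.bag ⟨i, h.1⟩).card else 0
    | 5 => if h : i < m then (((D.bag ⟨i, h⟩).sort (· ≤ ·)).map Fin.val).getD k 0 else 0
    | _ => 0
  real a i k :=
    match a with
    | 0 => if i = 0 ∧ k = 0 then ε else 0
    | 1 => if h : i < n then ((rowSupport A ⟨i, h⟩).map (A ⟨i, h⟩)).getD k 0 else 0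
    | _ => 0

/-! ## Program logic for the real RAM -/

namespace RealRAM

/-! Correctness. Put φ_i(w) = a_iᵀ(Aᵀ diag(w) A)⁻¹a_i, where a_iᵀ is the i-th row of A. One step of
the iteration multiplies w_i by φ_i(w), so the product of φ_i over the first T weight vectors
telescopes to the last weight divided by the initial weight d/n. Leverage scores are at most 1
(`leverageScore_le_one`), so this product is at most n/d. Since log φ_i is convex, the average u
satisfies φ_i(u)^T ≤ n/d (`dotProduct_inv_gram_average_pow_le`), and hence φ_i(u) ≤ 1 + ε as soon as
T ≥ 2ε⁻¹log(n/d). By Cauchy–Schwarz for the inner product of Aᵀ diag(u) A, this bound for all i is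
what places Q/√(1+ε) inside P (`smul_ellipsoid_subset`). The other inclusion only needs that the
weights add up to d (`polytope_subset`).

Running time. The columns occurring in one row of A form a clique of the column graph, so they lie
in a common bag. A step therefore needs only those entries of the inverse Gram matrix whose row and
column share a bag. Order the vertices by their highest bag. Among the vertices sharing a bag with
v, those not after v all lie in the highest bag of v (`mem_bag_of_le`). Eliminating from the last
vertex to the first thus creates no fill outside the bags (`EliminationState.eliminate`). Running
the order forwards, row v of the inverse is obtained from entries already known, all of them at
pairs sharing a bag (`BackSubstitution`, `runs_backCmd`). With bags of size at most B = τ + 1, each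
row of A and each vertex costs O(B²), and d ≤ n, so a step takes time O(nB²).

Number of steps. The machine has no logarithm. With x = n/d, the number 2^n(x^(1/2^n) − 1) comes
from n square roots and lies between log x and 2 log x; this determines T up to a constant factor.

Everything about programs is stated in a Hoare logic with time bounds (`Runs`), in which the arrays
left untouched by a program are read off its text. -/

@[simp] theorem State.setNat_real (s : State) (a i j v : ℕ) : (s.setNat a i j v).real = s.real := rfl

@[simp] theorem State.setReal_nat (s : State) (a i j : ℕ) (v : ℝ) :
    (s.setReal a i j v).nat = s.nat := rfl

theorem State.setNat_nat_of_ne (s : State) {a b : ℕ} (i j v : ℕ) (h : b ≠ a) :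
    (s.setNat a i j v).nat b = s.nat b := by
  funext i' j'
  simp [State.setNat, h]

theorem State.setReal_real_of_ne (s : State) {a b : ℕ} (i j : ℕ) (v : ℝ) (h : b ≠ a) :
    (s.setReal a i j v).real b = s.real b := by
  funext i' j'
  simp [State.setReal, h]

theorem State.setNat_nat_same (s : State) (a i j v i' j' : ℕ) :
    (s.setNat a i j v).nat a i' j' = if i' = i ∧ j' = j then v else s.nat a i' j' := by
  simp [State.setNat]

theorem State.setReal_real_same (s : State) (a i j : ℕ) (v : ℝ) (i' j' : ℕ) :
    (s.setReal a i j v).real a i' j' = if i' = i ∧ j' = j then v else s.real a i' j' := by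
  simp [State.setReal]

/-- The arrays of naturals that a program may write to. -/
@[simp] def Cmd.natWrites : Cmd → List ℕ
  | nop => []
  | setNat a _ _ _ => [a]
  | setReal _ _ _ _ => []
  | seq p q => p.natWrites ++ q.natWrites
  | ite _ p q => p.natWrites ++ q.natWrites
  | loop _ p => p.natWrites

/-- The arrays of reals that a program may write to. -/
@[simp] def Cmd.realWrites : Cmd → List ℕ
  | nop => []
  | setNat _ _ _ _ => []
  | setReal a _ _ _ => [a]
  | seq p q => p.realWrites ++ q.realWrites
  | ite _ p q => p.realWrites ++ q.realWrites
  | loop _ p => p.realWrites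

/-- Two memory states agree outside the listed arrays of naturals and of reals. -/
structure AgreeOff (W W' : List ℕ) (s s' : State) : Prop where
  nat : ∀ a, a ∉ W → s'.nat a = s.nat a
  real : ∀ a, a ∉ W' → s'.real a = s.real a

namespace AgreeOff

variable {W V W' V' : List ℕ} {s s' s'' : State}

theorem refl (W W' : List ℕ) (s : State) : AgreeOff W W' s s := ⟨fun _ _ => rfl, fun _ _ => rfl⟩

theorem trans (h : AgreeOff W W' s s') (h' : AgreeOff W W' s' s'') : AgreeOff W W' s s'' :=
  ⟨fun a ha => (h'.nat a ha).trans (h.nat a ha), fun a ha => (h'.real a ha).trans (h.real a ha)⟩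

theorem mono (h : AgreeOff W W' s s') (hW : W ⊆ V) (hW' : W' ⊆ V') : AgreeOff V V' s s' :=
  ⟨fun a ha => h.nat a fun h => ha (hW h), fun a ha => h.real a fun h => ha (hW' h)⟩

theorem setNat (W' : List ℕ) (s : State) {a : ℕ} (h : a ∈ W) (i j v : ℕ) :
    AgreeOff W W' s (s.setNat a i j v) :=
  ⟨fun _ hb => State.setNat_nat_of_ne s i j v fun e => hb (e ▸ h), fun _ _ => rfl⟩

theorem setReal (W : List ℕ) (s : State) {a : ℕ} (h : a ∈ W') (i j : ℕ) (v : ℝ) :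
    AgreeOff W W' s (s.setReal a i j v) :=
  ⟨fun _ _ => rfl, fun _ hb => State.setReal_real_of_ne s i j v fun e => hb (e ▸ h)⟩

end AgreeOff

/-- The frame rule. Since the arrays written are visible in the program text, postconditions and
invariants need to mention only what changes. -/
theorem Exec.agreeOff {p : Cmd} {s s' : State} {t : ℕ} (h : Exec p s s' t) :
    AgreeOff p.natWrites p.realWrites s s' := by
  induction h with
  | nop => exact .refl ..
  | setNat => exact .setNat _ _ (by simp) ..
  | setReal => exact .setReal _ _ (by simp) ..
  | seq _ _ ih ih' =>
    exact (ih.mono (by simp) (by simp)).trans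
      (ih'.mono (by simp) (by simp))
  | iteTrue _ _ ih => exact ih.mono (by simp) (by simp)
  | iteFalse _ _ ih => exact ih.mono (by simp) (by simp)
  | loopTrue _ _ _ ih ih' => exact ih.trans ih'
  | loopFalse => exact .refl ..

/-- Started in state `s`, the program `p` halts within time `c` in a state satisfying `Q`. -/
def Runs (p : Cmd) (s : State) (c : ℕ) (Q : State → Prop) : Prop :=
  ∃ s' t, Exec p s s' t ∧ t ≤ c ∧ Q s'

namespace Runs

variable {p q : Cmd} {s : State} {c c' : ℕ} {Q Q' : State → Prop}

theorem mono (h : Runs p s c Q) (hc : c ≤ c')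
    (hQ : ∀ s', AgreeOff p.natWrites p.realWrites s s' → Q s' → Q' s') : Runs p s c' Q' := by
  obtain ⟨s', t, he, ht, hs⟩ := h
  exact ⟨s', t, he, ht.trans hc, hQ s' he.agreeOff hs⟩

theorem seq (h : Runs p s c Q)
    (h' : ∀ s', AgreeOff p.natWrites p.realWrites s s' → Q s' → Runs q s' c' Q') :
    Runs (.seq p q) s (c + c') Q' := by
  obtain ⟨s', t, he, ht, hs⟩ := h
  obtain ⟨s'', t', he', ht', hs'⟩ := h' s' he.agreeOff hs
  exact ⟨s'', t + t', .seq he he', by omega, hs'⟩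

theorem nop (h : Q s) : Runs .nop s 1 Q := ⟨s, 1, .nop s, le_rfl, h⟩

theorem setNat {a : ℕ} {i j e : NExp}
    (h : Q (s.setNat a (i.eval s) (j.eval s) (e.eval s))) :
    Runs (.setNat a i j e) s (i.cost + j.cost + e.cost + 1) Q :=
  ⟨_, _, .setNat .., le_rfl, h⟩

theorem setReal {a : ℕ} {i j : NExp} {e : RExp}
    (h : Q (s.setReal a (i.eval s) (j.eval s) (e.eval s))) :
    Runs (.setReal a i j e) s (i.cost + j.cost + e.cost + 1) Q :=
  ⟨_, _, .setReal .., le_rfl, h⟩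

theorem ite {b : BExp} (h : b.holds s → Runs p s c Q) (h' : ¬ b.holds s → Runs q s c Q) :
    Runs (.ite b p q) s (b.cost + c + 1) Q := by
  by_cases hb : b.holds s
  · obtain ⟨s', t, he, ht, hs⟩ := h hb
    exact ⟨s', _, .iteTrue hb he, by omega, hs⟩
  · obtain ⟨s', t, he, ht, hs⟩ := h' hb
    exact ⟨s', _, .iteFalse hb he, by omega, hs⟩

/-- A loop whose test fails exactly after `N` rounds. -/
theorem loop {b : BExp} (Inv : ℕ → State → Prop) (N : ℕ)
    (hb : ∀ k ≤ N, ∀ s, Inv k s → (b.holds s ↔ k < N))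
    (hstep : ∀ k < N, ∀ s, Inv k s → Runs p s c (Inv (k + 1))) (h0 : Inv 0 s) :
    Runs (.loop b p) s (N * (c + b.cost + 1) + (b.cost + 1)) (Inv N) := by
  suffices H : ∀ r k, k + r = N → ∀ s, Inv k s →
      Runs (.loop b p) s (r * (c + b.cost + 1) + (b.cost + 1)) (Inv N) from H N 0 (by omega) s h0
  intro r
  induction r with
  | zero =>
    intro k hk s hs
    obtain rfl : k = N := by omega
    exact ⟨s, _, .loopFalse (by simp [hb k le_rfl s hs]), by omega, hs⟩
  | succ r ih =>
    intro k hk s hs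
    obtain ⟨s', t, he, ht, hs'⟩ := hstep k (by omega) s hs
    obtain ⟨s'', t', he', ht', hs''⟩ := ih (k + 1) (by omega) s' hs'
    refine ⟨s'', _, .loopTrue ((hb k (by omega) s hs).2 (by omega)) he he', ?_, hs''⟩
    rw [Nat.add_mul, Nat.one_mul]
    omega

end Runs

/-- A natural number variable: the entry `(0, 0)` of the array `r`. -/
def NExp.reg (r : ℕ) : NExp := .arr r (.lit 0) (.lit 0)

/-- A real variable: the entry `(0, 0)` of the array `r`. -/
def RExp.reg (r : ℕ) : RExp := .arr r (.lit 0) (.lit 0)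

/-- Execute `p` with the variable `r` running through `0, …, N - 1`. -/
def Cmd.forLoop (r : ℕ) (N : NExp) (p : Cmd) : Cmd :=
  .seq (.setNat r (.lit 0) (.lit 0) (.lit 0))
    (.loop (.natLt (.reg r) N)
      (.seq p (.setNat r (.lit 0) (.lit 0) (.add (.reg r) (.lit 1)))))

@[simp] theorem Cmd.natWrites_forLoop (r : ℕ) (N : NExp) (p : Cmd) :
    (Cmd.forLoop r N p).natWrites = r :: (p.natWrites ++ [r]) := rfl

@[simp] theorem Cmd.realWrites_forLoop (r : ℕ) (N : NExp) (p : Cmd) :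
    (Cmd.forLoop r N p).realWrites = p.realWrites := by
  simp [forLoop]

/-! ### Rules for counted loops -/

namespace Runs

variable {p : Cmd} {s : State} {r K B c c' : ℕ} {N : NExp}

/-- One round costs at most `c + N.cost + 13`, where 13 covers the test and the increment of the
counter. Initialisation and the final failing test cost less than one further round, which the
factor 3 absorbs because `1 ≤ B`. Bounding the number of rounds by `B` gives loops of varying
length, such as those over bags or rows, a uniform time bound. By `hreg` the invariant ignores the
counter, so it survives the increment. -/
theorem forLoop (Inv : ℕ → State → Prop) (hr : r ∉ p.natWrites)
    (hreg : ∀ k s v, Inv k s → Inv k (s.setNat r 0 0 v))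
    (hN : ∀ s', AgreeOff (r :: p.natWrites) p.realWrites s s' → N.eval s' = K)
    (h0 : Inv 0 s)
    (hstep : ∀ k < K, ∀ s', AgreeOff (r :: p.natWrites) p.realWrites s s' → s'.nat r 0 0 = k →
      Inv k s' → Runs p s' c (Inv (k + 1)))
    (hK : K ≤ B) (hB : 1 ≤ B) (hc : c + N.cost + 13 ≤ c') :
    Runs (.forLoop r N p) s (3 * B * c') (Inv K) := by
  have key := Runs.seq (p := .setNat r (.lit 0) (.lit 0) (.lit 0)) (s := s)
    (q := .loop (.natLt (.reg r) N)
      (.seq p (.setNat r (.lit 0) (.lit 0) (.add (.reg r) (.lit 1)))))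
    (Runs.setNat (Q := fun s' => s' = s.setNat r 0 0 0) rfl)
    (c' := K * ((c + 8) + (BExp.natLt (.reg r) N).cost + 1) + ((BExp.natLt (.reg r) N).cost + 1))
    (Q' := fun s' => AgreeOff (r :: p.natWrites) p.realWrites s s' ∧ s'.nat r 0 0 = K ∧ Inv K s')
    (by
      rintro _ - rfl
      refine Runs.loop (fun k s' => AgreeOff (r :: p.natWrites) p.realWrites s s' ∧
        s'.nat r 0 0 = k ∧ Inv k s') K ?_ ?_ ?_
      · rintro k - s' ⟨ha, hk, -⟩
        simp [BExp.holds, NExp.reg, NExp.eval, hk, hN s' ha]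
      · rintro k hk s' ⟨ha, hk', hi⟩
        refine Runs.seq (hstep k hk s' ha hk' hi) (c' := 8) ?_
        intro s'' ha' hi'
        refine Runs.setNat (e := .add (.reg r) (.lit 1)) ⟨?_, ?_, ?_⟩
        · exact (ha.trans (ha'.mono (by simp) (by simp))).trans (.setNat _ _ (by simp) ..)
        · simp [State.setNat_nat_same, NExp.eval, NExp.reg, ha'.nat r hr, hk']
        · exact hreg _ _ _ hi'
      · exact ⟨.setNat _ _ (by simp) .., by simp [State.setNat_nat_same], hreg _ _ _ h0⟩)
  refine key.mono ?_ fun _ _ h => h.2.2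
  simp only [NExp.cost, BExp.cost, NExp.reg]
  have h1 : K * (c + 8 + (1 + 1 + 1 + N.cost + 1) + 1) ≤ B * c' := Nat.mul_le_mul hK (by omega)
  have h2 : 1 * c' ≤ B * c' := Nat.mul_le_mul_right _ hB
  have h3 : 3 * B * c' = B * c' + B * c' + B * c' := by ring
  omega

variable {α : Type*} [DecidableEq α]

/-- A loop over a list without repetitions, with an invariant depending on the set of the
elements that have been processed. -/
theorem forEach (L : List α) (hL : L.Nodup) (Inv : Finset α → State → Prop)
    (hr : r ∉ p.natWrites)
    (hreg : ∀ S s v, Inv S s → Inv S (s.setNat r 0 0 v))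
    (hN : ∀ s', AgreeOff (r :: p.natWrites) p.realWrites s s' → N.eval s' = L.length)
    (h0 : Inv ∅ s)
    (hstep : ∀ (k : ℕ) (hk : k < L.length) (S : Finset α), L[k] ∉ S → ∀ s',
      AgreeOff (r :: p.natWrites) p.realWrites s s' → s'.nat r 0 0 = k →
      Inv S s' → Runs p s' c (Inv (insert L[k] S)))
    (hK : L.length ≤ B) (hB : 1 ≤ B) (hc : c + N.cost + 13 ≤ c') :
    Runs (.forLoop r N p) s (3 * B * c') (Inv L.toFinset) := by
  refine (Runs.forLoop (fun k => Inv (L.take k).toFinset) hr (fun _ => hreg _) hN (by simpa)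
    ?_ hK hB hc).mono le_rfl fun s' _ h => by simpa using h
  intro k hk s' ha hs' hi
  have htake : L.take (k + 1) = L.take k ++ [L[k]] := List.take_succ_eq_append_getElem hk
  have hnd : (L.take k ++ [L[k]]).Nodup := htake ▸ hL.sublist (List.take_sublist _ _)
  have hmem : L[k] ∉ (L.take k).toFinset := by
    rw [List.mem_toFinset]
    intro h
    exact (List.nodup_append.1 hnd).2.2 _ h _ (by simp) rfl
  refine (hstep k hk _ hmem s' ha hs' hi).mono le_rfl fun s'' _ h => ?_
  rw [htake]
  have : (L.take k ++ [L[k]]).toFinset = insert L[k] (L.take k).toFinset := by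
    ext x
    simp only [List.mem_toFinset, List.mem_append, List.mem_singleton, Finset.mem_insert]
    exact or_comm
  rwa [this]

/-- A loop over `0, …, n - 1`, with an invariant depending on the set of the numbers that have been
processed. -/
theorem forFin {n : ℕ} (Inv : Finset (Fin n) → State → Prop) (hr : r ∉ p.natWrites)
    (hreg : ∀ S s v, Inv S s → Inv S (s.setNat r 0 0 v))
    (hN : ∀ s', AgreeOff (r :: p.natWrites) p.realWrites s s' → N.eval s' = n)
    (h0 : Inv ∅ s)
    (hstep : ∀ (i : Fin n) (S : Finset (Fin n)), i ∉ S → ∀ s',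
      AgreeOff (r :: p.natWrites) p.realWrites s s' → s'.nat r 0 0 = i →
      Inv S s' → Runs p s' c (Inv (insert i S)))
    (hn : 1 ≤ n) (hc : c + N.cost + 13 ≤ c') :
    Runs (.forLoop r N p) s (3 * n * c') (Inv Finset.univ) := by
  refine (Runs.forEach (List.finRange n) (List.nodup_finRange n) Inv hr hreg
    (by simpa using hN) h0 ?_ (by simp) hn hc).mono le_rfl fun s' _ h => by simpa using h
  intro k hk S hS s' ha hs'
  exact hstep _ S hS s' ha (by simpa using hs')

/-- Adding up a function over a list in a real variable. -/
theorem sumLoop {a : ℕ} {e : RExp} (L : List α) (hL : L.Nodup) (f : α → ℝ)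
    (hN : ∀ s', AgreeOff [r] [a] s s' → N.eval s' = L.length)
    (he : ∀ (k : ℕ) (hk : k < L.length) (s' : State), AgreeOff [r] [a] s s' →
      s'.nat r 0 0 = k → e.eval s' = f L[k])
    (hK : L.length ≤ B) (hB : 1 ≤ B) (hc : e.cost + N.cost + 20 ≤ c') :
    Runs (.forLoop r N (.setReal a (.lit 0) (.lit 0) (.add (.reg a) e))) s (3 * B * c')
      (fun s' => s'.real a 0 0 = s.real a 0 0 + ∑ x ∈ L.toFinset, f x) := by
  refine Runs.forEach L hL (fun S s' => s'.real a 0 0 = s.real a 0 0 + ∑ x ∈ S, f x)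
    (by simp) (fun _ _ _ h => h) hN (by simp) ?_ hK hB
    (c := 1 + 1 + (RExp.add (.reg a) e).cost + 1) ?_
  · intro k hk S hS s' ha hs' hi
    refine Runs.setReal ?_
    simp only [State.setReal_real_same, NExp.eval, RExp.eval, RExp.reg, and_self, if_true, hi,
      he k hk s' ha hs', Finset.sum_insert hS]
    ring
  · simp only [RExp.cost, RExp.reg, NExp.cost]
    omega

/-- Adding a function to a square submatrix of an array of reals. -/
theorem updateLoop {d : ℕ} {a r' : ℕ} {x y : NExp} {e : RExp} (L : List (Fin d)) (hL : L.Nodup)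
    (f : Fin d → Fin d → ℝ) (hrr : r ≠ r')
    (hN : ∀ s', AgreeOff [r, r'] [a] s s' → N.eval s' = L.length)
    (hx : ∀ (k : ℕ) (hk : k < L.length) (s' : State), AgreeOff [r, r'] [a] s s' →
      s'.nat r 0 0 = k → x.eval s' = L[k])
    (hy : ∀ (k : ℕ) (hk : k < L.length) (s' : State), AgreeOff [r, r'] [a] s s' →
      s'.nat r' 0 0 = k → y.eval s' = L[k])
    (he : ∀ (k l : ℕ) (hk : k < L.length) (hl : l < L.length) (s' : State),
      AgreeOff [r, r'] [a] s s' → s'.nat r 0 0 = k → s'.nat r' 0 0 = l →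
      e.eval s' = f L[k] L[l])
    (hK : L.length ≤ B) (hB : 1 ≤ B)
    (hc : 2 * x.cost + 2 * y.cost + e.cost + N.cost + 20 ≤ c') :
    Runs (.forLoop r N (.forLoop r' N (.setReal a x y (.add (.arr a x y) e)))) s
      (12 * (B * B) * c')
      (fun s' => ∀ i j : Fin d, s'.real a i j =
        s.real a i j + if i ∈ L ∧ j ∈ L then f i j else 0) := by
  have hBc : 1 * c' ≤ B * c' := Nat.mul_le_mul_right _ hB
  refine (Runs.forEach L hL (fun S s' => ∀ i j : Fin d, s'.real a i j =
    s.real a i j + if i ∈ S ∧ j ∈ L then f i j else 0)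
    (by simp [hrr]) (fun _ _ _ h => h)
    (fun s' h => hN s' (h.mono (by simp)
      (by simp))) (by simp) ?_ hK hB
    (c := 3 * B * c') (c' := 4 * (B * c')) ?_).mono (le_of_eq (by ring)) (by simp)
  · intro k hk S hS s' ha hs' hi
    have ha' : AgreeOff [r, r'] [a] s s' := ha.mono (by simp)
      (by simp)
    refine (Runs.forEach L hL (fun S' s'' => ∀ i j : Fin d, s''.real a i j =
      s'.real a i j + if i = L[k] ∧ j ∈ S' then f i j else 0)
      (by simp) (fun _ _ _ h => h)
      (fun s'' h => hN s'' (ha'.trans (h.mono (by simp)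
        (by simp)))) (by simp) ?_ hK hB
      (c := x.cost + y.cost + (RExp.add (.arr a x y) e).cost + 1) ?_).mono le_rfl ?_
    · intro l hl S' hS' s'' hb hs'' hi'
      have hb' : AgreeOff [r, r'] [a] s s'' := ha'.trans (hb.mono (by simp)
        (by simp))
      have hk'' : s''.nat r 0 0 = k := by
        rw [hb.nat r (by simp [hrr]), hs']
      refine Runs.setReal fun i j => ?_
      rw [State.setReal_real_same]
      simp only [RExp.eval, hx k hk s'' hb' hk'', hy l hl s'' hb' hs'',
        he k l hk hl s'' hb' hk'' hs'', hi']
      by_cases hij : i = L[k] ∧ j = L[l]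
      · obtain ⟨rfl, rfl⟩ := hij
        simp [hS']
      · rw [if_neg (by simpa [Fin.ext_iff] using hij)]
        congr 1
        refine if_congr ?_ rfl rfl
        simp only [Finset.mem_insert]
        tauto
    · simp only [RExp.cost]
      omega
    · intro s'' _ h i j
      rw [h, hi, add_assoc]
      congr 1
      by_cases hik : i = L[k]
      · subst hik
        simp [hS]
      · simp [hik]
  · have : 3 * B * c' = 3 * (B * c') := by ring
    omega

end Runs

end RealRAM

/-! ## Elimination orders from tree decompositions -/

namespace TreeDecomposition

variable {V : Type*} {G : SimpleGraph V} {m : ℕ}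

/-- Counting edges: choosing one smaller neighbour for every node but the root yields distinct
edges, and there are as many of them as edges in the tree. So every edge arises in this way, and a
node has only one smaller neighbour. -/
theorem eq_of_adj_of_lt (D : TreeDecomposition G m) (hD : D.RootFirst) {s s' t : Fin m}
    (hs : D.tree.Adj s t) (hst : s < t) (hs' : D.tree.Adj s' t) (hst' : s' < t) : s = s' := by
  classical
  obtain ⟨m, rfl⟩ : ∃ k, m = k + 1 := ⟨m - 1, by have := t.2; omega⟩
  have hpar : ∀ t : Fin m, ∃ s : Fin (m + 1), s < t.succ ∧ D.tree.Adj s t.succ :=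
    fun t => hD t.succ (by simp)
  choose par hlt hadj using hpar
  have hinj : Function.Injective fun t : Fin m => s(par t, t.succ) := by
    intro a b hab
    rcases Sym2.eq_iff.1 hab with ⟨-, h⟩ | ⟨h, h'⟩
    · exact Fin.succ_injective _ h
    · exact absurd (hlt a) (by rw [h, h']; exact not_lt.2 (hlt b).le)
  have himg : Finset.univ.image (fun t : Fin m => s(par t, t.succ)) = D.tree.edgeFinset := by
    apply Finset.eq_of_subset_of_card_le
    · intro e he
      obtain ⟨t, -, rfl⟩ := Finset.mem_image.1 he
      simpa using hadj t
    · rw [Finset.card_image_of_injective _ hinj]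
      have := D.isTree.card_edgeFinset
      simp only [Fintype.card_fin, Finset.card_univ] at this ⊢
      omega
  have key : ∀ s : Fin (m + 1), D.tree.Adj s t → s < t → ∃ r : Fin m, r.succ = t ∧ par r = s := by
    intro s hs hst
    have : s(s, t) ∈ D.tree.edgeFinset := by simpa using hs
    rw [← himg] at this
    obtain ⟨r, -, hr⟩ := Finset.mem_image.1 this
    rcases Sym2.eq_iff.1 hr with ⟨h, h'⟩ | ⟨h, h'⟩
    · exact ⟨r, h', h⟩
    · exact absurd (hlt r) (by rw [h, h']; exact not_lt.2 hst.le)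
  obtain ⟨r, hr, rfl⟩ := key s hs hst
  obtain ⟨r', hr', rfl⟩ := key s' hs' hst'
  rw [Fin.succ_injective _ (hr.trans hr'.symm)]

/-- A connected set of nodes contains the parent of each of its nodes but the smallest one. -/
theorem exists_adj_lt_of_connected (D : TreeDecomposition G m) (hD : D.RootFirst)
    {S : Set (Fin m)} (hS : (D.tree.induce S).Connected) {r t : Fin m} (hr : r ∈ S) (ht : t ∈ S)
    (hrt : r < t) : ∃ s ∈ S, D.tree.Adj s t ∧ s < t := by
  by_contra! hcon
  -- The nodes from which `t` is reached by descending steps.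
  let R : Fin m → Fin m → Prop := fun x y => D.tree.Adj y x ∧ y < x
  have hle : ∀ x, Relation.ReflTransGen R x t → t ≤ x := by
    intro x hx
    induction hx using Relation.ReflTransGen.head_induction_on with
    | refl => exact le_rfl
    | head h _ ih => exact ih.trans h.2.le
  -- A walk inside `S` cannot leave the subtree below `t`. A downward step stays in it; an upward
  -- step from a node other than `t` leads to its unique parent, which lies on the path up to `t`;
  -- an upward step from `t` is excluded by `hcon`. But `r < t` is not in that subtree.
  have hstep : ∀ x y : S, (D.tree.induce S).Adj x y → Relation.ReflTransGen R x t →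
      Relation.ReflTransGen R y t := by
    intro x y hxy hx
    have hxy' : D.tree.Adj x y := hxy
    rcases lt_trichotomy (x : Fin m) y with h | h | h
    · exact .head ⟨hxy', h⟩ hx
    · exact absurd (h ▸ hxy') (D.tree.loopless.irrefl _)
    · rcases Relation.ReflTransGen.cases_head hx with h' | ⟨z, hz, hzt⟩
      · exact absurd h (not_lt.2 (h' ▸ hcon y y.2 (h' ▸ hxy'.symm)))
      · rwa [D.eq_of_adj_of_lt hD hxy'.symm h hz.1 hz.2]
  have hwalk : ∀ x y : S, (D.tree.induce S).Walk x y → Relation.ReflTransGen R x t →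
      Relation.ReflTransGen R y t := by
    intro x y w
    induction w with
    | nil => exact id
    | cons h _ ih => exact fun hx => ih (hstep _ _ h hx)
  obtain ⟨w⟩ := hS.preconnected ⟨t, ht⟩ ⟨r, hr⟩
  exact absurd hrt (not_lt.2 (hle _ (hwalk _ _ w .refl)))

/-- If `u` and `v` share a bag and `u` occurs above the highest bag `r` of `v`, then `u` lies
in `r`. -/
theorem mem_bag_of_le (D : TreeDecomposition G m) (hD : D.RootFirst) {u v : V} {q r : Fin m}
    (hu : u ∈ D.bag q) (hv : v ∈ D.bag r) (hr : ∀ t, v ∈ D.bag t → r ≤ t) (hqr : q ≤ r)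
    {t : Fin m} (htu : u ∈ D.bag t) (htv : v ∈ D.bag t) : u ∈ D.bag r := by
  -- Climb from `t` to `r`. As long as `r < t`, both vertices occur at a node smaller than `t` (`v`
  -- at `r`, `u` at `q`), so the parent of `t` contains both.
  induction t using WellFoundedLT.induction with
  | ind t ih =>
    rcases (hr t htv).eq_or_lt with rfl | h
    · exact htu
    · obtain ⟨s, hs, hst, hlt⟩ := D.exists_adj_lt_of_connected hD (D.connected v) hv htv h
      obtain ⟨s', hs', hst', hlt'⟩ :=
        D.exists_adj_lt_of_connected hD (D.connected u) hu htu (hqr.trans_lt h)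
      obtain rfl := D.eq_of_adj_of_lt hD hst hlt hst' hlt'
      exact ih s hlt hs' hs

theorem card_bag_le (D : TreeDecomposition G m) (t : Fin m) : (D.bag t).card ≤ D.width + 1 := by
  have : (D.bag t).card - 1 ≤ D.width :=
    Finset.le_sup (f := fun t => (D.bag t).card - 1) (Finset.mem_univ t)
  omega

end TreeDecomposition

/-- An elimination order for a family of bags: `pos v` is the position of the vertex `v`, and
among the vertices sharing a bag with `v`, those up to position `pos v` lie in the bag `top v`. -/
structure IsEliminationOrder {d m : ℕ} (bag : Fin m → Finset (Fin d)) (pos : Fin d ≃ Fin d)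
    (top : Fin d → Fin m) : Prop where
  mem : ∀ t u v, u ∈ bag t → v ∈ bag t → pos u ≤ pos v → u ∈ bag (top v)
  cover : ∀ v, ∃ t, v ∈ bag t

namespace IsEliminationOrder

variable {d m : ℕ} {bag : Fin m → Finset (Fin d)} {pos : Fin d ≃ Fin d} {top : Fin d → Fin m}

/-- Vertices which pairwise share bags all lie in one bag. -/
theorem exists_subset_bag (h : IsEliminationOrder bag pos top) {K : Finset (Fin d)}
    (hne : K.Nonempty) (hK : ∀ u ∈ K, ∀ v ∈ K, ∃ t, u ∈ bag t ∧ v ∈ bag t) :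
    ∃ t, K ⊆ bag t := by
  obtain ⟨v, hv, hmax⟩ := Finset.exists_max_image K pos hne
  refine ⟨top v, fun u hu => ?_⟩
  obtain ⟨t, hut, hvt⟩ := hK u hu v hv
  exact h.mem t u v hut hvt (hmax u hu)

end IsEliminationOrder

/-! ## Symmetric elimination -/

section Elimination

variable {d : ℕ}

/-- One step of symmetric Gaussian elimination with pivot `v`. -/
noncomputable def eliminate (M : Matrix (Fin d) (Fin d) ℝ) (v : Fin d) :
    Matrix (Fin d) (Fin d) ℝ :=
  fun j k => M j k - M v j / M v v * (M v k / M v v) * M v v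

/-- The state of the elimination of a matrix with inverse `G` when the vertices at positions
below `i` remain. -/
structure EliminationState {m : ℕ} (bag : Fin m → Finset (Fin d)) (pos : Fin d ≃ Fin d)
    (G : Matrix (Fin d) (Fin d) ℝ) (i : ℕ) (M : Matrix (Fin d) (Fin d) ℝ) : Prop where
  psd : M.PosSemidef
  -- Only the columns of remaining vertices: a Schur complement is inverse to the corresponding
  -- block of `G`, not to all of `G`.
  mul_eq : ∀ k, (pos k : ℕ) < i → ∀ j, (M * G) j k = if j = k then 1 else 0
  sparse : ∀ j k, M j k ≠ 0 → ∃ t, j ∈ bag t ∧ k ∈ bag t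
  supp : ∀ j k, M j k ≠ 0 → (pos j : ℕ) < i

/-- The numbers `c` and `p` determine the row of the inverse matrix `G` at `v` from the rows of
the vertices at smaller positions. -/
structure BackSubstitution (B : Finset (Fin d)) (pos : Fin d ≃ Fin d)
    (G : Matrix (Fin d) (Fin d) ℝ) (v : Fin d) (c : Fin d → ℝ) (p : ℝ) : Prop where
  lt : ∀ x ∈ B, c x ≠ 0 → pos x < pos v
  off : ∀ k, pos k < pos v → G v k = - ∑ x ∈ B, c x * G x k
  diag : G v v = 1 / p - ∑ x ∈ B, c x * G x v

/-- Needed because the array of multipliers is controlled only on the bag; elsewhere it may hold old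
values. -/
theorem BackSubstitution.congr {B : Finset (Fin d)} {pos : Fin d ≃ Fin d}
    {G : Matrix (Fin d) (Fin d) ℝ} {v : Fin d} {c c' : Fin d → ℝ} {p : ℝ}
    (h : BackSubstitution B pos G v c p) (hc : ∀ x ∈ B, c' x = c x) :
    BackSubstitution B pos G v c' p where
  lt x hx hx' := h.lt x hx (hc x hx ▸ hx')
  off k hk := (h.off k hk).trans
    (congrArg _ (Finset.sum_congr rfl fun x hx => congrArg (· * G x k) (hc x hx).symm))
  diag := h.diag.trans
    (congrArg _ (Finset.sum_congr rfl fun x hx => congrArg (· * G x v) (hc x hx).symm))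

variable {m : ℕ} {bag : Fin m → Finset (Fin d)} {pos : Fin d ≃ Fin d} {top : Fin d → Fin m}
  {G M : Matrix (Fin d) (Fin d) ℝ}

theorem Matrix.PosSemidef.apply_comm (hM : M.PosSemidef) (j k : Fin d) : M j k = M k j := by
  simpa using (hM.isHermitian.apply j k).symm

namespace EliminationState

variable {v : Fin d}

/-- A positive semidefinite matrix with a zero diagonal entry has a zero column there, which
contradicts the diagonal entry 1 of `M * G`. -/
theorem pivot_ne_zero (h : EliminationState bag pos G (pos v + 1) M) : M v v ≠ 0 := by
  intro h0
  have h1 : M *ᵥ Pi.single v 1 = 0 := by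
    rw [← h.psd.dotProduct_mulVec_zero_iff]
    simp [h0]
  have h2 := h.mul_eq v (Nat.lt_succ_self _) v
  rw [if_pos rfl, Matrix.mul_apply, Finset.sum_eq_zero] at h2
  · exact zero_ne_one h2
  · intro x _
    have := congrFun h1 x
    rw [Matrix.mulVec_single_one] at this
    rw [h.psd.apply_comm v x, show M x v = 0 from this, zero_mul]

/-- This is where the elimination order prevents fill-in: the pivot row lives inside a single bag.
-/
theorem row_supp (h : EliminationState bag pos G (pos v + 1) M)
    (ho : IsEliminationOrder bag pos top) {j : Fin d} (hj : M v j ≠ 0) :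
    j ∈ bag (top v) ∧ pos j ≤ pos v := by
  obtain ⟨t, hvt, hjt⟩ := h.sparse v j hj
  have hle : pos j ≤ pos v := Nat.lt_succ_iff.1 (h.supp j v (by rwa [h.psd.apply_comm]))
  exact ⟨ho.mem t j v hjt hvt hle, hle⟩

theorem sum_row (h : EliminationState bag pos G (pos v + 1) M) {k : Fin d} (hk : pos k ≤ pos v) :
    ∑ x, M v x / M v v * G x k = if v = k then 1 / M v v else 0 := by
  have := h.mul_eq k (Nat.lt_succ_of_le hk) v
  rw [Matrix.mul_apply] at this
  simp only [div_mul_eq_mul_div, ← Finset.sum_div, this]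
  split_ifs <;> simp

/-- The result is the Schur complement. It stays inverse to the smaller block because multiples of
row `v` are subtracted and row `v` of `M * G` vanishes in the columns that remain. New nonzero
entries join two vertices of the pivot row, which share the bag `top v`. -/
theorem eliminate (h : EliminationState bag pos G (pos v + 1) M)
    (ho : IsEliminationOrder bag pos top) :
    EliminationState bag pos G (pos v) (eliminate M v) where
  psd := by
    have hp := h.pivot_ne_zero
    refine .of_dotProduct_mulVec_nonneg ?_ fun x => ?_
    · ext j k
      simp [_root_.eliminate, h.psd.apply_comm j k, mul_comm]
    -- Completing the square: the form of `M` at this shifted vector equals the form of the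
    -- eliminated matrix at `x`.
    · have := h.psd.dotProduct_mulVec_nonneg
        (x - Pi.single v (∑ j, M v j / M v v * x j))
      set S := ∑ j, M v j / M v v * x j with hS
      have hMx : (M *ᵥ x) v = S * M v v := by
        simp only [Matrix.mulVec, dotProduct, hS, Finset.sum_mul]
        refine Finset.sum_congr rfl fun j _ => ?_
        field_simp
      have hxM : x ⬝ᵥ (M *ᵥ Pi.single v S) = S * (S * M v v) := by
        rw [← hMx, Matrix.mulVec_single, Matrix.mulVec, dotProduct, dotProduct, Finset.mul_sum]
        refine Finset.sum_congr rfl fun j _ => ?_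
        simp [h.psd.apply_comm j v]
        ring
      have hE : _root_.eliminate M v *ᵥ x = fun j => (M *ᵥ x) j - M v j * S := by
        funext j
        simp only [Matrix.mulVec, dotProduct, hS, Finset.mul_sum, ← Finset.sum_sub_distrib,
          _root_.eliminate]
        refine Finset.sum_congr rfl fun k _ => ?_
        field_simp
      have hxE : x ⬝ᵥ (_root_.eliminate M v *ᵥ x) = x ⬝ᵥ (M *ᵥ x) - S * (S * M v v) := by
        rw [hE, ← hMx]
        simp only [dotProduct, mul_sub, Finset.sum_sub_distrib]
        congr 1
        simp only [Matrix.mulVec, dotProduct, Finset.mul_sum]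
        refine Finset.sum_congr rfl fun j _ => ?_
        ring
      simp only [star_trivial] at this ⊢
      rw [hxE]
      rw [Matrix.mulVec_sub, sub_dotProduct, dotProduct_sub, dotProduct_sub, hxM,
        single_dotProduct, single_dotProduct, hMx] at this
      rw [Matrix.mulVec_single] at this
      simp at this
      nlinarith
  mul_eq k hk j := by
    have hkv : pos k ≤ pos v := hk.le
    have hne : v ≠ k := by rintro rfl; exact lt_irrefl _ hk
    have h1 := h.mul_eq k (hk.trans (Nat.lt_succ_self _)) j
    have h2 := h.sum_row hkv
    rw [if_neg hne] at h2
    rw [Matrix.mul_apply] at h1 ⊢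
    have : ∀ x, _root_.eliminate M v j x * G x k =
        M j x * G x k - M v j * (M v x / M v v * G x k) := by
      intro x
      have := h.pivot_ne_zero
      simp only [_root_.eliminate]
      field_simp
    simp only [this, Finset.sum_sub_distrib, ← Finset.mul_sum, h2, h1, mul_zero, sub_zero]
  sparse j k hjk := by
    by_cases hM : M j k = 0
    · have hj : M v j ≠ 0 := by
        intro h0; exact hjk (by simp [_root_.eliminate, hM, h0])
      have hk : M v k ≠ 0 := by
        intro h0; exact hjk (by simp [_root_.eliminate, hM, h0])
      exact ⟨top v, (h.row_supp ho hj).1, (h.row_supp ho hk).1⟩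
    · exact h.sparse j k hM
  supp j k hjk := by
    have hp := h.pivot_ne_zero
    have hne : j ≠ v := by
      rintro rfl
      apply hjk
      simp only [_root_.eliminate]
      field_simp
      ring
    have hle : pos j ≤ pos v := by
      by_cases hM : M j k = 0
      · refine (h.row_supp ho (j := j) ?_).2
        intro h0; exact hjk (by simp [_root_.eliminate, hM, h0])
      · exact Nat.lt_succ_iff.1 (h.supp j k hM)
    exact lt_of_le_of_ne hle fun e => hne (pos.injective (Fin.ext e))

/-- Row `v` of `M * G`, divided by the pivot and solved for the entry of `G` in row `v`, whose
coefficient is 1. The coefficient at `v` itself is replaced by 0 so that the sum may run over the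
whole bag. -/
theorem backSubstitution (h : EliminationState bag pos G (pos v + 1) M)
    (ho : IsEliminationOrder bag pos top) :
    BackSubstitution (bag (top v)) pos G v (fun x => if x = v then 0 else M v x / M v v)
      (M v v) := by
  have hp := h.pivot_ne_zero
  have key : ∀ k, pos k ≤ pos v → ∑ x ∈ bag (top v), (if x = v then 0 else M v x / M v v) * G x k
      = (if v = k then 1 / M v v else 0) - G v k := by
    intro k hk
    rw [← h.sum_row hk, Finset.sum_subset (Finset.subset_univ _),
      ← Finset.add_sum_erase _ _ (Finset.mem_univ v), ← Finset.add_sum_erase Finset.univ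
        (fun x => M v x / M v v * G x k) (Finset.mem_univ v)]
    · rw [if_pos rfl, div_self hp]
      rw [Finset.sum_congr rfl fun x hx => by rw [if_neg (Finset.ne_of_mem_erase hx)]]
      ring
    · intro x _ hx
      have : M v x = 0 := by
        by_contra h0
        exact hx (h.row_supp ho h0).1
      simp [this]
  refine ⟨fun x _ hx => ?_, fun k hk => ?_, ?_⟩
  · have hne : x ≠ v := by rintro rfl; simp at hx
    rw [if_neg hne] at hx
    refine lt_of_le_of_ne (h.row_supp ho (j := x) ?_).2 fun e => hne (pos.injective e)
    intro h0
    simp [h0] at hx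
  · rw [key k hk.le, if_neg (by rintro rfl; exact lt_irrefl _ hk)]
    ring
  · rw [key v le_rfl, if_pos rfl]
    ring

end EliminationState

end Elimination

/-! ## The fixed-point iteration -/

section Iteration

variable {n d : ℕ} {A : Matrix (Fin n) (Fin d) ℝ}

theorem gram_apply (A : Matrix (Fin n) (Fin d) ℝ) (w : Fin n → ℝ) (j k : Fin d) :
    (Aᵀ * Matrix.diagonal w * A) j k = ∑ i, w i * A i j * A i k := by
  rw [Matrix.mul_apply]
  refine Finset.sum_congr rfl fun i _ => ?_
  rw [Matrix.mul_diagonal, Matrix.transpose_apply]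
  ring

theorem dotProduct_gram_mulVec (A : Matrix (Fin n) (Fin d) ℝ) (w : Fin n → ℝ) (x : Fin d → ℝ) :
    x ⬝ᵥ ((Aᵀ * Matrix.diagonal w * A) *ᵥ x) = ∑ i, w i * (A *ᵥ x) i ^ 2 := by
  rw [← Matrix.mulVec_mulVec, ← Matrix.mulVec_mulVec, Matrix.dotProduct_mulVec,
    Matrix.vecMul_transpose]
  simp only [dotProduct, Matrix.mulVec_diagonal]
  refine Finset.sum_congr rfl fun i _ => ?_
  ring

theorem isHermitian_gram (A : Matrix (Fin n) (Fin d) ℝ) (w : Fin n → ℝ) :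
    (Aᵀ * Matrix.diagonal w * A).IsHermitian := by
  ext j k
  simp only [Matrix.conjTranspose_apply, star_trivial, gram_apply]
  exact Finset.sum_congr rfl fun i _ => by ring

theorem mulVec_injective_of_rank (h : A.rank = d) {x : Fin d → ℝ} (hx : A *ᵥ x = 0) : x = 0 := by
  have h1 := A.mulVecLin.finrank_range_add_finrank_ker
  rw [← Matrix.rank, h, Module.finrank_fin_fun, Nat.add_eq_left, Submodule.finrank_eq_zero] at h1
  exact (LinearMap.ker_eq_bot'.1 h1) x hx

/-- Positivity is required only at nonzero rows, because a zero row of `A` has weight 0 after the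
first step. A row with `(A *ᵥ x) i ≠ 0` is nonzero, which is all the argument uses. -/
theorem posDef_gram (h : A.rank = d) {w : Fin n → ℝ} (hw : ∀ i, 0 ≤ w i)
    (hpos : ∀ i, A i ≠ 0 → 0 < w i) : (Aᵀ * Matrix.diagonal w * A).PosDef := by
  refine .of_dotProduct_mulVec_pos (isHermitian_gram A w) fun x hx => ?_
  rw [star_trivial, dotProduct_gram_mulVec]
  have hne : A *ᵥ x ≠ 0 := fun h0 => hx (mulVec_injective_of_rank h h0)
  obtain ⟨i, hi⟩ := Function.ne_iff.1 hne
  refine Finset.sum_pos' (fun i _ => mul_nonneg (hw i) (sq_nonneg _))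
    ⟨i, Finset.mem_univ _, mul_pos (hpos i ?_) (sq_pos_of_ne_zero hi)⟩
  intro h0
  apply hi
  rw [Matrix.mulVec, h0, zero_dotProduct, Pi.zero_apply]

/-- The ratio of successive weights becomes a quadratic form in the inverse Gram matrix. This gives
the telescoping product and also spares the program the square roots of the weights. -/
theorem leverageScore_sqrt_mul {w : Fin n → ℝ} (hw : ∀ i, 0 ≤ w i) (i : Fin n) :
    leverageScore (Matrix.diagonal (fun i => √(w i)) * A) i =
      w i * (A i ⬝ᵥ ((Aᵀ * Matrix.diagonal w * A)⁻¹ *ᵥ A i)) := by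
  have h1 : (Matrix.diagonal (fun i => √(w i)) * A)ᵀ * (Matrix.diagonal (fun i => √(w i)) * A) =
      Aᵀ * Matrix.diagonal w * A := by
    rw [Matrix.transpose_mul, Matrix.diagonal_transpose, Matrix.mul_assoc, ← Matrix.mul_assoc _ _ A,
      Matrix.diagonal_mul_diagonal, ← Matrix.mul_assoc]
    simp only [Real.mul_self_sqrt (hw _)]
  have h2 : (Matrix.diagonal (fun i => √(w i)) * A) i = √(w i) • A i := by
    ext j
    simp
  rw [leverageScore, h1, h2, Matrix.mulVec_smul, smul_dotProduct, dotProduct_smul, smul_eq_mul,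
    smul_eq_mul, ← mul_assoc, Real.mul_self_sqrt (hw i)]

theorem leverageScore_sqrt_mul_eq_sum {w : Fin n → ℝ} (hw : ∀ i, 0 ≤ w i) (i : Fin n) :
    leverageScore (Matrix.diagonal (fun i => √(w i)) * A) i =
      w i * ∑ j, ∑ k, A i j * A i k * (Aᵀ * Matrix.diagonal w * A)⁻¹ j k := by
  rw [leverageScore_sqrt_mul hw]
  simp only [dotProduct, Matrix.mulVec, Finset.mul_sum]
  refine Finset.sum_congr rfl fun j _ => Finset.sum_congr rfl fun k _ => ?_
  ring

theorem fixedPointIterate_nonneg_and_pos (h : A.rank = d) (hd : 0 < d) (k : ℕ) (i : Fin n) :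
    0 ≤ fixedPointIterate A k i ∧ (A i ≠ 0 → 0 < fixedPointIterate A k i) := by
  induction k generalizing i with
  | zero =>
    have hn : 0 < n := i.pos
    have : (0 : ℝ) < (d : ℝ) / n := by positivity
    exact ⟨this.le, fun _ => this⟩
  | succ k ih =>
    have hP := posDef_gram h (fun i => (ih i).1) (fun i => (ih i).2)
    rw [fixedPointIterate, leverageScore_sqrt_mul fun i => (ih i).1]
    refine ⟨mul_nonneg (ih i).1 ?_, fun hi => mul_pos ((ih i).2 hi) ?_⟩
    · simpa using hP.inv.posSemidef.dotProduct_mulVec_nonneg (A i)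
    · simpa using hP.inv.dotProduct_mulVec_pos hi

theorem fixedPointIterate_nonneg (h : A.rank = d) (hd : 0 < d) (k : ℕ) (i : Fin n) :
    0 ≤ fixedPointIterate A k i :=
  (fixedPointIterate_nonneg_and_pos h hd k i).1

theorem fixedPointIterate_pos (h : A.rank = d) (hd : 0 < d) (k : ℕ) {i : Fin n} (hi : A i ≠ 0) :
    0 < fixedPointIterate A k i :=
  (fixedPointIterate_nonneg_and_pos h hd k i).2 hi

theorem posDef_gram_iterate (h : A.rank = d) (hd : 0 < d) (k : ℕ) :
    (Aᵀ * Matrix.diagonal (fixedPointIterate A k) * A).PosDef :=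
  posDef_gram h (fixedPointIterate_nonneg h hd k) fun _ => fixedPointIterate_pos h hd k

/-- Cauchy–Schwarz for the inner product given by a positive definite matrix. -/
theorem Matrix.PosDef.sq_dotProduct_le {M : Matrix (Fin d) (Fin d) ℝ} (hM : M.PosDef)
    (a x : Fin d → ℝ) : (a ⬝ᵥ x) ^ 2 ≤ (a ⬝ᵥ (M⁻¹ *ᵥ a)) * (x ⬝ᵥ (M *ᵥ x)) := by
  have hdet : IsUnit M.det := hM.det_pos.ne'.isUnit
  set y := M⁻¹ *ᵥ a with hy
  have hMy : M *ᵥ y = a := by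
    rw [hy, Matrix.mulVec_mulVec, Matrix.mul_nonsing_inv _ hdet, Matrix.one_mulVec]
  have hsymm : y ⬝ᵥ (M *ᵥ x) = a ⬝ᵥ x := by
    have hT : Mᵀ = M := by simpa using hM.isHermitian.eq
    rw [Matrix.dotProduct_mulVec, ← Matrix.mulVec_transpose, hT, hMy]
  have key : ∀ r s : ℝ, 0 ≤ r * r * (a ⬝ᵥ y) - 2 * (r * s) * (a ⬝ᵥ x) + s * s * (x ⬝ᵥ (M *ᵥ x)) := by
    intro r s
    have := hM.posSemidef.dotProduct_mulVec_nonneg (r • y - s • x)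
    simp only [star_trivial, Matrix.mulVec_sub, Matrix.mulVec_smul, hMy, sub_dotProduct,
      dotProduct_sub, smul_dotProduct, dotProduct_smul, smul_eq_mul, hsymm,
      dotProduct_comm x a, dotProduct_comm y a] at this
    linarith
  rcases (show 0 ≤ a ⬝ᵥ y by simpa using key 1 0).eq_or_lt with h0 | h0
  · have h1 : a = 0 := by
      by_contra ha
      have := hM.inv.dotProduct_mulVec_pos ha
      rw [star_trivial, ← hy, ← h0] at this
      exact lt_irrefl _ this
    simp [h1]
  -- For these values the form equals `a ⬝ᵥ y` times the difference of the two sides, and `a ⬝ᵥ y`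
  -- is positive.
  · have := key (a ⬝ᵥ x) (a ⬝ᵥ y)
    nlinarith

/-- With x = M⁻¹a_i one has a_i·x = xᵀMx = ∑_j w_j(a_j·x)² ≥ w_i(a_i·x)²; divide by a_i·x when it is
positive. -/
theorem leverageScore_le_one (h : A.rank = d) {w : Fin n → ℝ} (hw : ∀ i, 0 ≤ w i)
    (hpos : ∀ i, A i ≠ 0 → 0 < w i) (i : Fin n) :
    leverageScore (Matrix.diagonal (fun i => √(w i)) * A) i ≤ 1 := by
  have hP := posDef_gram h hw hpos
  have hdet : IsUnit (Aᵀ * Matrix.diagonal w * A).det := hP.det_pos.ne'.isUnit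
  rw [leverageScore_sqrt_mul hw]
  set M := Aᵀ * Matrix.diagonal w * A with hM
  set x := M⁻¹ *ᵥ A i with hx
  have hMx : M *ᵥ x = A i := by
    rw [hx, Matrix.mulVec_mulVec, Matrix.mul_nonsing_inv _ hdet, Matrix.one_mulVec]
  have h1 : x ⬝ᵥ (M *ᵥ x) = ∑ i, w i * (A *ᵥ x) i ^ 2 := dotProduct_gram_mulVec A w x
  have h2 : w i * (A i ⬝ᵥ x) ^ 2 ≤ A i ⬝ᵥ x := by
    calc w i * (A i ⬝ᵥ x) ^ 2 ≤ ∑ i, w i * (A *ᵥ x) i ^ 2 :=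
          Finset.single_le_sum (f := fun i => w i * (A *ᵥ x) i ^ 2)
            (fun i _ => mul_nonneg (hw i) (sq_nonneg _)) (Finset.mem_univ i)
      _ = A i ⬝ᵥ x := by rw [← h1, hMx, dotProduct_comm]
  rcases le_or_gt (A i ⬝ᵥ x) 0 with h0 | h0
  · exact (mul_nonpos_of_nonneg_of_nonpos (hw i) h0).trans zero_le_one
  · refine le_of_mul_le_mul_right ?_ h0
    rw [one_mul, mul_assoc, ← sq]
    exact h2

/-- After the first vector, the weights add up to the trace of the Gram matrix times its inverse,
that is, of the d × d identity. -/
theorem sum_fixedPointIterate (h : A.rank = d) (hd : 0 < d) (hn : 0 < n) (k : ℕ) :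
    ∑ i, fixedPointIterate A k i = d := by
  cases k with
  | zero =>
    simp only [fixedPointIterate, Finset.sum_const, Finset.card_univ, Fintype.card_fin,
      nsmul_eq_mul]
    field_simp
  | succ k =>
    have hP := posDef_gram_iterate h hd k
    have hdet := hP.det_pos.ne'.isUnit
    have h1 : ∑ i, fixedPointIterate A (k + 1) i =
        ((Aᵀ * Matrix.diagonal (fixedPointIterate A k) * A) *
          (Aᵀ * Matrix.diagonal (fixedPointIterate A k) * A)⁻¹).trace := by
      have h2 : ∀ j, ((Aᵀ * Matrix.diagonal (fixedPointIterate A k) * A) *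
          (Aᵀ * Matrix.diagonal (fixedPointIterate A k) * A)⁻¹) j j = ∑ l, ∑ i,
          fixedPointIterate A k i * (A i j * A i l *
            (Aᵀ * Matrix.diagonal (fixedPointIterate A k) * A)⁻¹ j l) := by
        intro j
        rw [Matrix.mul_apply]
        refine Finset.sum_congr rfl fun l _ => ?_
        have hsymm := hP.inv.isHermitian.apply j l
        rw [star_trivial] at hsymm
        rw [gram_apply, hsymm, Finset.sum_mul]
        refine Finset.sum_congr rfl fun i _ => ?_
        ring
      simp only [fixedPointIterate,
        leverageScore_sqrt_mul_eq_sum (fixedPointIterate_nonneg h hd k), Matrix.trace,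
        Matrix.diag, h2, Finset.mul_sum]
      rw [Finset.sum_comm]
      exact Finset.sum_congr rfl fun j _ => Finset.sum_comm
    rw [h1, Matrix.mul_nonsing_inv _ hdet, Matrix.trace_one, Fintype.card_fin]

theorem rank_le_of_rank_eq (h : A.rank = d) : d ≤ n := by
  simpa [h] using A.rank_le_height

/-! ### The two inclusions for the averaged weights -/

variable {T : ℕ}

theorem posDef_gram_average (h : A.rank = d) (hd : 0 < d) (hT : 0 < T) :
    (Aᵀ * Matrix.diagonal (averageIterate A T) * A).PosDef := by
  refine posDef_gram h (fun i => ?_) fun i hi => ?_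
  · exact div_nonneg (Finset.sum_nonneg fun k _ => fixedPointIterate_nonneg h hd k i)
      (Nat.cast_nonneg _)
  · exact div_pos (Finset.sum_pos (fun k _ => fixedPointIterate_pos h hd k hi)
      ⟨0, Finset.mem_range.2 hT⟩) (Nat.cast_pos.2 hT)

/-- On the polytope every (Ax)_i² is at most 1, so the quadratic form is at most the sum of the
averaged weights, which is d. -/
theorem polytope_subset (h : A.rank = d) (hd : 0 < d) (hn : 0 < n) (hT : 0 < T) :
    polytope A ⊆ √(d : ℝ) • ellipsoid (Aᵀ * Matrix.diagonal (averageIterate A T) * A) := by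
  intro x hx
  have hd' : (0 : ℝ) < d := Nat.cast_pos.2 hd
  have hs : √(d : ℝ) ≠ 0 := (Real.sqrt_pos.2 hd').ne'
  rw [Set.mem_smul_set_iff_inv_smul_mem₀ hs]
  rw [ellipsoid, Set.mem_ofPred_eq, Matrix.mulVec_smul, smul_dotProduct, dotProduct_smul,
    smul_eq_mul, smul_eq_mul, ← mul_assoc, ← mul_inv, Real.mul_self_sqrt hd'.le,
    dotProduct_gram_mulVec, inv_mul_le_iff₀ hd', mul_one]
  have hT' : (0 : ℝ) < T := Nat.cast_pos.2 hT
  have hsum : ∑ i, averageIterate A T i = d := by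
    simp only [averageIterate, ← Finset.sum_div]
    rw [Finset.sum_comm]
    simp only [sum_fixedPointIterate h hd hn, Finset.sum_const, Finset.card_range, nsmul_eq_mul]
    field_simp
  rw [← hsum]
  refine Finset.sum_le_sum fun i _ => ?_
  have hu : 0 ≤ averageIterate A T i :=
    div_nonneg (Finset.sum_nonneg fun k _ => fixedPointIterate_nonneg h hd k i)
      (Nat.cast_nonneg _)
  have h1 : -1 ≤ (A *ᵥ x) i := hx.1 i
  have h2 : (A *ᵥ x) i ≤ 1 := hx.2 i
  have : (A *ᵥ x) i ^ 2 ≤ 1 := by nlinarith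
  nlinarith

theorem prod_range_le_mean_pow (hT : 0 < T) {q : ℕ → ℝ} (hq : ∀ k, 0 ≤ q k) :
    ∏ k ∈ Finset.range T, q k ≤ ((∑ k ∈ Finset.range T, q k) / T) ^ T := by
  have hprod : 0 ≤ ∏ k ∈ Finset.range T, q k := Finset.prod_nonneg fun k _ => hq k
  have := Real.geom_mean_le_arith_mean (Finset.range T) (fun _ => 1) q (by simp)
    (by simpa using hT) fun k _ => hq k
  simp only [Real.rpow_one, Finset.sum_const, Finset.card_range, nsmul_eq_mul, mul_one,
    one_mul] at this
  calc ∏ k ∈ Finset.range T, q k = ((∏ k ∈ Finset.range T, q k) ^ ((T : ℝ)⁻¹)) ^ T :=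
        (Real.rpow_inv_natCast_pow hprod hT.ne').symm
    _ ≤ _ := pow_le_pow_left₀ (Real.rpow_nonneg hprod _) this T

/-- The log-convexity of the map from weights to `aᵀ (Aᵀ W A)⁻¹ a`. -/
theorem dotProduct_inv_gram_average_pow_le (h : A.rank = d) (hd : 0 < d) (hT : 0 < T)
    (a : Fin d → ℝ) :
    (a ⬝ᵥ ((Aᵀ * Matrix.diagonal (averageIterate A T) * A)⁻¹ *ᵥ a)) ^ T ≤
      ∏ k ∈ Finset.range T,
        a ⬝ᵥ ((Aᵀ * Matrix.diagonal (fixedPointIterate A k) * A)⁻¹ *ᵥ a) := by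
  rcases eq_or_ne a 0 with rfl | ha
  · simp [hT.ne']
  have hT' : (0 : ℝ) < T := Nat.cast_pos.2 hT
  have hP := posDef_gram_average h hd hT
  have hdet := hP.det_pos.ne'.isUnit
  set M := Aᵀ * Matrix.diagonal (averageIterate A T) * A with hM
  -- Let q_k be the form of the k-th Gram matrix at this x. Cauchy–Schwarz bounds (a·x)² by the k-th
  -- factor on the right times q_k. Gram matrices are linear in the weights, so the q_k have mean
  -- a·x, and by AM–GM their product is at most (a·x)^T. Multiplying over k and cancelling (a·x)^T
  -- gives the claim.
  set x := M⁻¹ *ᵥ a with hx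
  have hMx : M *ᵥ x = a := by
    rw [hx, Matrix.mulVec_mulVec, Matrix.mul_nonsing_inv _ hdet, Matrix.one_mulVec]
  have hax : 0 < a ⬝ᵥ x := by simpa using hP.inv.dotProduct_mulVec_pos ha
  have hx0 : x ≠ 0 := by
    rintro h0
    simp [h0] at hax
  let q : ℕ → ℝ := fun k => x ⬝ᵥ ((Aᵀ * Matrix.diagonal (fixedPointIterate A k) * A) *ᵥ x)
  have hq : ∀ k, 0 < q k := fun k => by
    simpa using (posDef_gram_iterate h hd k).dotProduct_mulVec_pos hx0
  have hqsum : (∑ k ∈ Finset.range T, q k) / T = a ⬝ᵥ x := by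
    have h1 : x ⬝ᵥ (M *ᵥ x) = a ⬝ᵥ x := by rw [hMx, dotProduct_comm]
    rw [← h1, hM, dotProduct_gram_mulVec]
    simp only [q, dotProduct_gram_mulVec, averageIterate]
    rw [Finset.sum_comm, Finset.sum_div]
    refine Finset.sum_congr rfl fun i _ => ?_
    rw [← Finset.sum_mul]
    ring
  have hamgm : ∏ k ∈ Finset.range T, q k ≤ (a ⬝ᵥ x) ^ T := by
    rw [← hqsum]
    exact prod_range_le_mean_pow hT fun k => (hq k).le
  have hmul : (a ⬝ᵥ x) ^ T * (a ⬝ᵥ x) ^ T ≤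
      (∏ k ∈ Finset.range T, a ⬝ᵥ ((Aᵀ * Matrix.diagonal (fixedPointIterate A k) * A)⁻¹ *ᵥ a)) *
        ∏ k ∈ Finset.range T, q k := by
    rw [← Finset.prod_mul_distrib, ← mul_pow, ← sq]
    calc ((a ⬝ᵥ x) ^ 2) ^ T = ∏ k ∈ Finset.range T, (a ⬝ᵥ x) ^ 2 := by simp
      _ ≤ _ := Finset.prod_le_prod (fun _ _ => sq_nonneg _) fun k _ =>
        (posDef_gram_iterate h hd k).sq_dotProduct_le a x
  have hprod : 0 ≤ ∏ k ∈ Finset.range T,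
      a ⬝ᵥ ((Aᵀ * Matrix.diagonal (fixedPointIterate A k) * A)⁻¹ *ᵥ a) :=
    Finset.prod_nonneg fun k _ => by
      simpa using (posDef_gram_iterate h hd k).inv.posSemidef.dotProduct_mulVec_nonneg a
  exact le_of_mul_le_mul_right (hmul.trans (mul_le_mul_of_nonneg_left hamgm hprod))
    (pow_pos hax T)

theorem smul_ellipsoid_subset (h : A.rank = d) (hd : 0 < d) (hn : 0 < n) {ε : ℝ} (hε : 0 < ε)
    (hε1 : ε < 1) (hT : 0 < T) (hTε : 2 * (ε⁻¹ * Real.log ((n : ℝ) / d)) ≤ T) :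
    (1 / √(1 + ε)) • ellipsoid (Aᵀ * Matrix.diagonal (averageIterate A T) * A) ⊆ polytope A := by
  have hP := posDef_gram_average h hd hT
  have hd' : (0 : ℝ) < d := Nat.cast_pos.2 hd
  have hn' : (0 : ℝ) < n := Nat.cast_pos.2 hn
  have hT' : (0 : ℝ) < T := Nat.cast_pos.2 hT
  set M := Aᵀ * Matrix.diagonal (averageIterate A T) * A with hM
  have hbound : ∀ i, A i ⬝ᵥ (M⁻¹ *ᵥ A i) ≤ 1 + ε := by
    intro i
    rcases eq_or_ne (A i) 0 with h0 | h0
    · simp only [h0, zero_dotProduct]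
      linarith
    -- Each factor is the ratio of two successive weights of row `i`.
    have htel : ∏ k ∈ Finset.range T,
        A i ⬝ᵥ ((Aᵀ * Matrix.diagonal (fixedPointIterate A k) * A)⁻¹ *ᵥ A i) =
          fixedPointIterate A T i / fixedPointIterate A 0 i := by
      have hstep : ∀ S, (∏ k ∈ Finset.range S,
          A i ⬝ᵥ ((Aᵀ * Matrix.diagonal (fixedPointIterate A k) * A)⁻¹ *ᵥ A i)) *
            fixedPointIterate A 0 i = fixedPointIterate A S i := by
        intro S
        induction S with
        | zero => simp
        | succ S ih =>
          rw [Finset.prod_range_succ, mul_right_comm, ih, fixedPointIterate.eq_2,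
            leverageScore_sqrt_mul (fixedPointIterate_nonneg h hd S)]
      rw [eq_div_iff (fixedPointIterate_pos h hd 0 h0).ne', hstep]
    -- Since `T` is positive, the last weight is a leverage score; the first is d/n.
    have hle : fixedPointIterate A T i / fixedPointIterate A 0 i ≤ n / d := by
      obtain ⟨T, rfl⟩ : ∃ k, T = k + 1 := ⟨T - 1, by omega⟩
      have := leverageScore_le_one h (fixedPointIterate_nonneg h hd T)
        (fun _ => fixedPointIterate_pos h hd T) i
      calc fixedPointIterate A (T + 1) i / fixedPointIterate A 0 i
          ≤ 1 / fixedPointIterate A 0 i :=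
            div_le_div_of_nonneg_right this (fixedPointIterate_nonneg h hd 0 i)
        _ = n / d := by simp [fixedPointIterate]
    have h1 := (dotProduct_inv_gram_average_pow_le h hd hT (A i)).trans (htel.le.trans hle)
    have hpow : (n : ℝ) / d ≤ (1 + ε) ^ T := by
      -- From log(1+ε) ≥ ε/(1+ε) and ε < 1. This is the origin of the factor 2 in `hTε`.
      have hlog : ε / 2 ≤ Real.log (1 + ε) := by
        have := Real.one_sub_inv_le_log_of_pos (show 0 < 1 + ε by linarith)
        refine le_trans ?_ this
        rw [← sub_nonneg]
        have : 1 - (1 + ε)⁻¹ - ε / 2 = ε * (1 - ε) / (2 * (1 + ε)) := by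
          field_simp
          ring
        rw [this]
        exact div_nonneg (mul_nonneg hε.le (by linarith)) (by linarith)
      rw [← Real.log_le_log_iff (by positivity) (by positivity), Real.log_pow]
      have h2 : Real.log ((n : ℝ) / d) = ε / 2 * (2 * (ε⁻¹ * Real.log ((n : ℝ) / d))) := by
        field_simp
      rw [h2, mul_comm (T : ℝ)]
      have hdn : (1 : ℝ) ≤ n / d := by
        rw [one_le_div hd']
        exact_mod_cast rank_le_of_rank_eq h
      have := Real.log_nonneg hdn
      exact mul_le_mul hlog hTε (by positivity) (by linarith)
    exact le_of_pow_le_pow_left₀ hT.ne' (by linarith) (h1.trans hpow)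
  rintro _ ⟨x, hx, rfl⟩
  have hs : (0 : ℝ) < 1 + ε := by linarith
  have habs : ∀ i, |(A *ᵥ ((1 / √(1 + ε)) • x)) i| ≤ 1 := by
    intro i
    rw [← sq_le_one_iff_abs_le_one, Matrix.mulVec_smul, Pi.smul_apply, smul_eq_mul, mul_pow,
      div_pow, Real.sq_sqrt hs.le, one_pow, one_div, inv_mul_le_iff₀ hs, mul_one]
    calc (A *ᵥ x) i ^ 2 ≤ (A i ⬝ᵥ (M⁻¹ *ᵥ A i)) * (x ⬝ᵥ (M *ᵥ x)) := hP.sq_dotProduct_le (A i) x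
      _ ≤ (1 + ε) * 1 := mul_le_mul (hbound i) hx
          (by simpa using hP.posSemidef.dotProduct_mulVec_nonneg x) hs.le
      _ = 1 + ε := mul_one _
  exact ⟨fun i => (abs_le.1 (habs i)).1, fun i => (abs_le.1 (habs i)).2⟩

end Iteration

/-! ## Approximating the logarithm by iterated square roots -/

/-- The number `2 ^ k * (y - 1)` with `y ^ 2 ^ k = x` is a good approximation to `log x`. -/
theorem log_le_two_pow_mul_sub_one {x y : ℝ} {k : ℕ} (hy : 1 ≤ y) (hyx : y ^ 2 ^ k = x) :
    Real.log x ≤ 2 ^ k * (y - 1) := by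
  rw [← hyx, Real.log_pow]
  push_cast
  exact mul_le_mul_of_nonneg_left (Real.log_le_sub_one_of_pos (by linarith)) (by positivity)

/-- For 1 ≤ y ≤ 2 one has log y ≥ 1 − 1/y ≥ (y − 1)/2. The bound y ≤ 2 holds because y > 2 would
give x ≥ 2^(2^k) > k. So k roots suffice whenever x ≤ k, in particular n roots for x = n/d. -/
theorem two_pow_mul_sub_one_le_log {x y : ℝ} {k : ℕ} (hy : 1 ≤ y) (hyx : y ^ 2 ^ k = x)
    (hx : x ≤ k) : 2 ^ k * (y - 1) ≤ 2 * Real.log x := by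
  have hy2 : y ≤ 2 := by
    by_contra! h2
    have h3 : (2 : ℝ) ^ 2 ^ k ≤ y ^ 2 ^ k := pow_le_pow_left₀ (by norm_num) h2.le _
    have h4 : ((2 ^ 2 ^ k : ℕ) : ℝ) ≤ (k : ℕ) := by
      push_cast
      linarith
    have h5 : 2 ^ 2 ^ k ≤ k := by exact_mod_cast h4
    have h6 : k < 2 ^ k := Nat.lt_two_pow_self
    have h7 : 2 ^ k < 2 ^ 2 ^ k := Nat.lt_two_pow_self
    omega
  have hlog : y - 1 ≤ 2 * Real.log y := by
    have h1 := Real.one_sub_inv_le_log_of_pos (show 0 < y by linarith)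
    have h2 : (y - 1) / 2 ≤ 1 - y⁻¹ := by
      rw [← sub_nonneg]
      have : 1 - y⁻¹ - (y - 1) / 2 = (y - 1) * (2 - y) / (2 * y) := by
        field_simp
      rw [this]
      exact div_nonneg (mul_nonneg (by linarith) (by linarith)) (by linarith)
    linarith
  rw [← hyx, Real.log_pow]
  push_cast
  have : (0 : ℝ) < 2 ^ k := by positivity
  nlinarith

/-! ## One step of the fixed-point iteration on the real RAM -/

namespace RealRAM

variable {n d m : ℕ} {A : Matrix (Fin n) (Fin d) ℝ} {ε : ℝ}
  {D : TreeDecomposition (columnGraph A) m} {pos : Fin d ≃ Fin d} {top : Fin d → Fin m}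

/-! ### The input and the elimination order in memory -/

theorem nodup_rowSupport (A : Matrix (Fin n) (Fin d) ℝ) (i : Fin n) : (rowSupport A i).Nodup :=
  Finset.sort_nodup ..

theorem mem_rowSupport {i : Fin n} {j : Fin d} : j ∈ rowSupport A i ↔ A i j ≠ 0 := by
  simp [rowSupport]

/-- The list of the elements of a bag that the input provides. -/
def bagList (D : TreeDecomposition (columnGraph A) m) (t : Fin m) : List (Fin d) :=
  (D.bag t).sort (· ≤ ·)

theorem nodup_bagList (D : TreeDecomposition (columnGraph A) m) (t : Fin m) :
    (bagList D t).Nodup :=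
  Finset.sort_nodup ..

@[simp] theorem mem_bagList {t : Fin m} {j : Fin d} : j ∈ bagList D t ↔ j ∈ D.bag t := by
  simp [bagList]

@[simp] theorem toFinset_bagList (t : Fin m) : (bagList D t).toFinset = D.bag t := by
  simp [bagList]

theorem length_bagList (t : Fin m) : (bagList D t).length = (D.bag t).card := by
  simp [bagList]

/-- The memory contains the input. -/
structure HasInput (A : Matrix (Fin n) (Fin d) ℝ) (ε : ℝ) (D : TreeDecomposition (columnGraph A) m)
    (s : State) : Prop where
  nat : ∀ a < 6, s.nat a = (inputState A ε D).nat a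
  real : ∀ a < 2, s.real a = (inputState A ε D).real a

namespace HasInput

variable {s s' : State}

/-- The input arrays are never overwritten. Working arrays of naturals: 6 the elimination order, 7
the highest bags, 8 flags for listed vertices, 9 the length of the list, 10 to 12 loop counters, 13
the number of iterations. Working arrays of reals: 2 the sum of the weights and finally the output,
3 the Gram matrix, 4 the multipliers, 5 the pivots, 6 the inverse matrix, 7 the weights, 8 the
required number of iterations, 9 and 10 scratch. -/
theorem of_agreeOff (h : HasInput A ε D s) {W W' : List ℕ} (ha : AgreeOff W W' s s')
    (hW : ∀ a ∈ W, 6 ≤ a) (hW' : ∀ a ∈ W', 2 ≤ a) : HasInput A ε D s' where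
  nat a h' := by rw [ha.nat a fun h => absurd (hW a h) (by omega), h.nat a h']
  real a h' := by rw [ha.real a fun h => absurd (hW' a h) (by omega), h.real a h']

variable (h : HasInput A ε D s)
include h

theorem numRows : s.nat 0 0 0 = n := by simp [h.nat, inputState]

theorem numCols : s.nat 0 0 1 = d := by simp [h.nat, inputState]

theorem numBags : s.nat 0 0 2 = m := by simp [h.nat, inputState]

theorem eps : s.real 0 0 0 = ε := by simp [h.real, inputState]

theorem rowLen (i : Fin n) : s.nat 1 i 0 = (rowSupport A i).length := by
  simp [h.nat, inputState]

theorem rowCol (i : Fin n) {k : ℕ} (hk : k < (rowSupport A i).length) :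
    s.nat 2 i k = (rowSupport A i)[k] := by
  simp [h.nat, inputState, hk]

theorem rowVal (i : Fin n) {k : ℕ} (hk : k < (rowSupport A i).length) :
    s.real 1 i k = A i (rowSupport A i)[k] := by
  simp [h.real, inputState, hk]

theorem bagLen (t : Fin m) : s.nat 4 t 0 = (bagList D t).length := by
  simp [h.nat, inputState, length_bagList]

theorem bagElem (t : Fin m) {k : ℕ} (hk : k < (bagList D t).length) :
    s.nat 5 t k = (bagList D t)[k] := by
  have hk' : k < (D.bag t).card := by rwa [length_bagList] at hk
  simp [h.nat, inputState, hk', bagList]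

end HasInput

/-- The memory contains the input and an elimination order with the corresponding bags. -/
structure HasOrder (A : Matrix (Fin n) (Fin d) ℝ) (ε : ℝ) (D : TreeDecomposition (columnGraph A) m)
    (pos : Fin d ≃ Fin d) (top : Fin d → Fin m) (s : State) : Prop extends HasInput A ε D s where
  order : ∀ i : Fin d, s.nat 6 i 0 = pos.symm i
  topBag : ∀ v : Fin d, s.nat 7 v 0 = top v

theorem HasOrder.of_agreeOff {s s' : State} (h : HasOrder A ε D pos top s) {W W' : List ℕ}
    (ha : AgreeOff W W' s s') (hW : ∀ a ∈ W, 8 ≤ a) (hW' : ∀ a ∈ W', 2 ≤ a) :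
    HasOrder A ε D pos top s' where
  toHasInput := h.toHasInput.of_agreeOff ha (fun a h => by have := hW a h; omega) hW'
  order i := by rw [ha.nat 6 fun h => absurd (hW 6 h) (by omega), h.order i]
  topBag v := by rw [ha.nat 7 fun h => absurd (hW 7 h) (by omega), h.topBag v]

/-! ### Access to the input -/

/-- The number of rows. -/
def numRows : NExp := .arr 0 (.lit 0) (.lit 0)

/-- The number of columns. -/
def numCols : NExp := .arr 0 (.lit 0) (.lit 1)

/-- The number of bags. -/
def numBags : NExp := .arr 0 (.lit 0) (.lit 2)

/-- The number of nonzero entries in the current row. -/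
def rowLen : NExp := .arr 1 (.reg 10) (.lit 0)

/-- The column of a nonzero entry of the current row. -/
def rowCol (r : ℕ) : NExp := .arr 2 (.reg 10) (.reg r)

/-- The value of a nonzero entry of the current row. -/
def rowVal (r : ℕ) : RExp := .arr 1 (.reg 10) (.reg r)

/-- The number of elements of the bag of the vertex `v`. -/
def topLen (v : NExp) : NExp := .arr 4 (.arr 7 v (.lit 0)) (.lit 0)

/-- An element of the bag of the vertex `v`. -/
def topElem (v : NExp) (r : ℕ) : NExp := .arr 5 (.arr 7 v (.lit 0)) (.reg r)

@[simp] theorem NExp.eval_lit (s : State) (c : ℕ) : (NExp.lit c).eval s = c := rfl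

@[simp] theorem NExp.eval_reg (s : State) (r : ℕ) : (NExp.reg r).eval s = s.nat r 0 0 := rfl

@[simp] theorem RExp.eval_reg (s : State) (r : ℕ) : (RExp.reg r).eval s = s.real r 0 0 := rfl

section Eval

variable {s : State}

theorem HasInput.eval_numRows (h : HasInput A ε D s) : RealRAM.numRows.eval s = n := h.numRows

theorem HasInput.eval_numCols (h : HasInput A ε D s) : RealRAM.numCols.eval s = d := h.numCols

theorem HasInput.eval_numBags (h : HasInput A ε D s) : RealRAM.numBags.eval s = m := h.numBags

theorem HasInput.eval_rowLen (h : HasInput A ε D s) {i : Fin n} (hi : s.nat 10 0 0 = i) :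
    RealRAM.rowLen.eval s = (rowSupport A i).length := by
  simp [RealRAM.rowLen, NExp.eval, hi, h.rowLen]

theorem HasInput.eval_rowCol (h : HasInput A ε D s) {i : Fin n} (hi : s.nat 10 0 0 = i)
    {r k : ℕ} (hr : s.nat r 0 0 = k) (hk : k < (rowSupport A i).length) :
    (RealRAM.rowCol r).eval s = (rowSupport A i)[k] := by
  simp [RealRAM.rowCol, NExp.eval, hi, hr, h.rowCol i hk]

theorem HasInput.eval_rowVal (h : HasInput A ε D s) {i : Fin n} (hi : s.nat 10 0 0 = i)
    {r k : ℕ} (hr : s.nat r 0 0 = k) (hk : k < (rowSupport A i).length) :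
    (RealRAM.rowVal r).eval s = A i (rowSupport A i)[k] := by
  simp [RealRAM.rowVal, RExp.eval, hi, hr, h.rowVal i hk]

theorem HasOrder.eval_topLen (h : HasOrder A ε D pos top s) {v : NExp} {x : Fin d}
    (hv : v.eval s = x) : (topLen v).eval s = (bagList D (top x)).length := by
  simp [topLen, NExp.eval, hv, h.topBag, h.bagLen]

theorem HasOrder.eval_topElem (h : HasOrder A ε D pos top s) {v : NExp} {x : Fin d}
    (hv : v.eval s = x) {r k : ℕ} (hr : s.nat r 0 0 = k) (hk : k < (bagList D (top x)).length) :
    (topElem v r).eval s = (bagList D (top x))[k] := by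
  simp [topElem, NExp.eval, hv, h.topBag, h.bagElem _ hk, hr]

end Eval

/-! ### The matrix of the current weights -/

/-- Compute `Aᵀ W A`. -/
def gramCmd : Cmd :=
  .forLoop 10 numRows (.forLoop 11 rowLen (.forLoop 12 rowLen
    (.setReal 3 (rowCol 11) (rowCol 12) (.add (.arr 3 (rowCol 11) (rowCol 12))
      (.mul (.mul (.arr 7 (.reg 10) (.lit 0)) (rowVal 11)) (rowVal 12))))))

/-- The program only adds to array 3, so the array must be zero at the start. Clearing d² entries in
each step would be too slow; instead, elimination leaves the array zero. -/
theorem runs_gramCmd {s : State} {w : Fin n → ℝ} {B : ℕ} (h : HasInput A ε D s)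
    (hw : ∀ i : Fin n, s.real 7 i 0 = w i) (hM : ∀ j k : Fin d, s.real 3 j k = 0)
    (hB : ∀ i, (rowSupport A i).length ≤ B) (hB1 : 1 ≤ B) (hn : 1 ≤ n) :
    Runs gramCmd s (6000 * (n * (B * B)))
      (fun s' => ∀ j k : Fin d, s'.real 3 j k = (Aᵀ * Matrix.diagonal w * A) j k) := by
  have hBB : B ≤ B * B := Nat.le_mul_self B
  refine (Runs.forFin (fun S s' => ∀ j k : Fin d, s'.real 3 j k = ∑ i ∈ S, w i * A i j * A i k)
    (by simp) (fun _ _ _ h => h)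
    (fun s' ha => (h.of_agreeOff ha (by simp) (by simp)).eval_numRows) (by simpa using hM)
    (c := 12 * (B * B) * 120) (c' := 12 * (B * B) * 120 + 20 * (B * B)) ?_ hn ?_).mono ?_ ?_
  · intro i S hS s' ha hi hM'
    refine (Runs.updateLoop (rowSupport A i) (nodup_rowSupport A i)
      (fun j k => w i * A i j * A i k) (by simp) ?_ ?_ ?_ ?_ (hB i) hB1 ?_).mono le_rfl ?_
    · intro s'' hb
      have hab := ha.trans (hb.mono (by simp) (by simp))
      exact (h.of_agreeOff hab (by simp) (by simp)).eval_rowLen (by rw [hb.nat 10 (by simp), hi])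
    · intro k hk s'' hb hr
      have hab := ha.trans (hb.mono (by simp) (by simp))
      exact (h.of_agreeOff hab (by simp) (by simp)).eval_rowCol
        (by rw [hb.nat 10 (by simp), hi]) hr hk
    · intro k hk s'' hb hr
      have hab := ha.trans (hb.mono (by simp) (by simp))
      exact (h.of_agreeOff hab (by simp) (by simp)).eval_rowCol
        (by rw [hb.nat 10 (by simp), hi]) hr hk
    · intro k l hk hl s'' hb hr hr'
      have hab := ha.trans (hb.mono (by simp) (by simp))
      have hin := h.of_agreeOff hab (by simp) (by simp)
      have hi' : s''.nat 10 0 0 = i := by rw [hb.nat 10 (by simp), hi]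
      simp only [RExp.eval, hin.eval_rowVal hi' hr hk, hin.eval_rowVal hi' hr' hl,
        NExp.eval_reg, NExp.eval_lit, hi', hab.real 7 (by simp), hw]
    · simp [rowCol, rowVal, rowLen, NExp.cost, RExp.cost, NExp.reg]
    · intro s'' _ hs'' j k
      rw [hs'', hM', Finset.sum_insert hS, add_comm]
      congr 1
      by_cases hj : A i j = 0 <;> by_cases hk : A i k = 0 <;> simp [mem_rowSupport, hj, hk]
  · simp only [numRows, NExp.cost]
    omega
  · calc 3 * n * (12 * (B * B) * 120 + 20 * (B * B)) = 4380 * (n * (B * B)) := by ring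
      _ ≤ _ := Nat.mul_le_mul_right _ (by norm_num)
  · intro s' _ hs' j k
    rw [hs', gram_apply]

/-! ### Elimination -/

/-- Eliminate the vertex `v`. -/
def eliminateCmd (v : NExp) : Cmd :=
  .seq (.setReal 5 v (.lit 0) (.arr 3 v v))
  (.seq (.forLoop 11 (topLen v) (.setReal 4 v (topElem v 11)
    (.div (.arr 3 v (topElem v 11)) (.arr 5 v (.lit 0)))))
  (.seq (.forLoop 11 (topLen v) (.forLoop 12 (topLen v)
    (.setReal 3 (topElem v 11) (topElem v 12) (.add (.arr 3 (topElem v 11) (topElem v 12))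
      (.sub (.ofNat (.lit 0)) (.mul (.mul (.arr 4 v (topElem v 11)) (.arr 4 v (topElem v 12)))
        (.arr 5 v (.lit 0))))))))
  -- During the update the multiplier of `v` is 1, which clears row and column `v`; the pivot
  -- survives in array 5. Setting the multiplier to 0 afterwards removes `v` from the sums of the
  -- back substitution.
  (.setReal 4 v v (.ofNat (.lit 0)))))

@[simp] theorem natWrites_eliminateCmd (v : NExp) :
    (eliminateCmd v).natWrites = [11, 11, 11, 12, 12, 11] := rfl

@[simp] theorem realWrites_eliminateCmd (v : NExp) :
    (eliminateCmd v).realWrites = [5, 4, 3, 4] := rfl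

/-- Updating inside the bag of `x` suffices, as the pivot row vanishes outside it. The last clause
protects the multipliers and pivots of vertices eliminated earlier. -/
theorem runs_eliminateCmd {s : State} {v : NExp} {x : Fin d} {G M : Matrix (Fin d) (Fin d) ℝ}
    {B : ℕ} (h : HasOrder A ε D pos top s) (ho : IsEliminationOrder D.bag pos top)
    (hv : ∀ s', AgreeOff [11, 12] [3, 4, 5] s s' → v.eval s' = x) (hvc : v.cost ≤ 12)
    (hM : ∀ j k : Fin d, s.real 3 j k = M j k)
    (he : EliminationState D.bag pos G (pos x + 1) M)
    (hB : ∀ t, (bagList D t).length ≤ B) (hB1 : 1 ≤ B) :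
    Runs (eliminateCmd v) s (6000 * (B * B)) (fun s' =>
      (∀ j k : Fin d, s'.real 3 j k = eliminate M x j k) ∧
      BackSubstitution (D.bag (top x)) pos G x (fun y => s'.real 4 x y) (s'.real 5 x 0) ∧
      ∀ u : Fin d, u ≠ x → s'.real 5 u 0 = s.real 5 u 0 ∧
        ∀ y : Fin d, s'.real 4 u y = s.real 4 u y) := by
  have hBB : B ≤ B * B := Nat.le_mul_self B
  have hord : ∀ s', AgreeOff [11, 12] [3, 4, 5] s s' → HasOrder A ε D pos top s' :=
    fun s' ha => h.of_agreeOff ha (by simp) (by simp)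
  have hx := hv s (.refl ..)
  refine (Runs.seq (c' := 3 * B * 140 + (12 * (B * B) * 240 + 100))
    (Runs.setReal (Q := fun s' => s' = s.setReal 5 x 0 (M x x)) ?_) ?_).mono ?_ fun _ _ h => h
  · simp [hx, RExp.eval, hM]
  · rintro s₁ ha₁ rfl
    have ha₁ : AgreeOff [11, 12] [3, 4, 5] s (s.setReal 5 x 0 (M x x)) := ha₁.mono (by simp) (by simp)
    set s₁ := s.setReal 5 x 0 (M x x) with hs₁
    have h5 : ∀ u : Fin d, s₁.real 5 u 0 = if u = x then M x x else s.real 5 u 0 := by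
      intro u
      simp [hs₁, State.setReal_real_same, Fin.ext_iff]
    have h3 : ∀ j k : Fin d, s₁.real 3 j k = M j k := by
      intro j k
      rw [hs₁, State.setReal_real_of_ne _ _ _ _ (by simp), hM]
    refine Runs.seq (Runs.forEach (bagList D (top x)) (nodup_bagList _ _)
      (fun S s' => ∀ u y : Fin d, s'.real 4 u y =
        if u = x ∧ y ∈ S then M x y / M x x else s.real 4 u y) (by simp) (fun _ _ _ h => h)
      ?_ ?_ (c := 100) ?_ (hB _) hB1 ?_) ?_
    · intro s' ha
      have hab := ha₁.trans (ha.mono (by simp) (by simp))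
      exact (hord _ hab).eval_topLen (hv _ hab)
    · intro u y
      simp [hs₁, State.setReal_real_of_ne]
    · intro k hk S hS s' ha hr hi
      have hab := ha₁.trans (ha.mono (by simp) (by simp))
      refine (Runs.setReal ?_).mono ?_ fun _ _ h => h
      · intro u y
        rw [State.setReal_real_same]
        simp only [RExp.eval, hv _ hab, (hord _ hab).eval_topElem (hv _ hab) hr hk, NExp.eval_lit,
          ha.real 3 (by simp), ha.real 5 (by simp), h5, h3, if_true, hi]
        by_cases hu : u = x ∧ y = (bagList D (top x))[k]
        · obtain ⟨rfl, rfl⟩ := hu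
          simp
        · rw [if_neg (by simpa [Fin.ext_iff] using hu)]
          refine if_congr ?_ rfl rfl
          simp only [Finset.mem_insert]
          tauto
      · simp only [topElem, NExp.cost, RExp.cost, NExp.reg]
        omega
    · simp only [topLen, NExp.cost]
      omega
    · intro s₂ ha₂ h4
      have hab₂ := ha₁.trans (ha₂.mono (by simp) (by simp))
      have h52 : ∀ u : Fin d, s₂.real 5 u 0 = if u = x then M x x else s.real 5 u 0 := by
        intro u
        rw [ha₂.real 5 (by simp), h5]
      have h32 : ∀ j k : Fin d, s₂.real 3 j k = M j k := by
        intro j k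
        rw [ha₂.real 3 (by simp), h3]
      refine Runs.seq (Runs.updateLoop (bagList D (top x)) (nodup_bagList _ _)
        (fun j k => 0 - M x j / M x x * (M x k / M x x) * M x x) (by simp) ?_ ?_ ?_ ?_
        (hB _) hB1 ?_) ?_
      · intro s' ha
        have hab := hab₂.trans (ha.mono (by simp) (by simp))
        exact (hord _ hab).eval_topLen (hv _ hab)
      · intro k hk s' ha hr
        have hab := hab₂.trans (ha.mono (by simp) (by simp))
        exact (hord _ hab).eval_topElem (hv _ hab) hr hk
      · intro k hk s' ha hr
        have hab := hab₂.trans (ha.mono (by simp) (by simp))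
        exact (hord _ hab).eval_topElem (hv _ hab) hr hk
      · intro k l hk hl s' ha hr hr'
        have hab := hab₂.trans (ha.mono (by simp) (by simp))
        have hmk : (bagList D (top x))[k] ∈ D.bag (top x) := mem_bagList.1 (List.getElem_mem hk)
        have hml : (bagList D (top x))[l] ∈ D.bag (top x) := mem_bagList.1 (List.getElem_mem hl)
        simp only [RExp.eval, hv _ hab, (hord _ hab).eval_topElem (hv _ hab) hr hk,
          (hord _ hab).eval_topElem (hv _ hab) hr' hl, NExp.eval_lit, ha.real 4 (by simp),
          ha.real 5 (by simp), h4, h52, if_true, toFinset_bagList, hmk, hml, and_self,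
          Nat.cast_zero]
      · simp only [topElem, topLen, NExp.cost, RExp.cost, NExp.reg]
        omega
      · intro s₃ ha₃ h3
        have hab₃ := hab₂.trans (ha₃.mono (by simp) (by simp))
        refine (Runs.setReal ?_).mono (c' := 100) ?_ fun _ _ h => h
        · rw [hv _ hab₃]
          have h4' : ∀ u y : Fin d, (s₃.setReal 4 x x (RExp.eval s₃ (.ofNat (.lit 0)))).real 4 u y =
              if u = x then (if y = x then 0 else if y ∈ D.bag (top x) then M x y / M x x else
                s.real 4 u y) else s.real 4 u y := by
            intro u y
            rw [State.setReal_real_same, ha₃.real 4 (by simp), h4]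
            by_cases hu : u = x
            · by_cases hy : y = x <;> simp [hu, hy, RExp.eval, Fin.val_inj]
            · simp [hu, Fin.val_inj]
          have h5' : ∀ u : Fin d, (s₃.setReal 4 x x (RExp.eval s₃ (.ofNat (.lit 0)))).real 5 u 0 =
              if u = x then M x x else s.real 5 u 0 := by
            intro u
            rw [State.setReal_real_of_ne _ _ _ _ (by simp), ha₃.real 5 (by simp), h52]
          refine ⟨?_, ?_, ?_⟩
          · intro j k
            rw [State.setReal_real_of_ne _ _ _ _ (by simp), h3, h32, eliminate]
            by_cases hj : M x j = 0
            · simp [hj]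
            by_cases hk : M x k = 0
            · simp [hk]
            rw [if_pos ⟨mem_bagList.2 (he.row_supp ho hj).1, mem_bagList.2 (he.row_supp ho hk).1⟩]
            ring
          · have := he.backSubstitution ho
            rw [h5', if_pos rfl]
            refine this.congr fun y hy => ?_
            rw [h4', if_pos rfl, if_pos hy]
          · intro u hu
            exact ⟨by rw [h5', if_neg hu], fun y => by rw [h4', if_neg hu]⟩
        · simp only [NExp.cost, RExp.cost]
          omega
  · simp only [NExp.cost, RExp.cost]
    omega

/-- Eliminate all vertices. -/
def eliminateAllCmd : Cmd :=
  .forLoop 10 numCols (eliminateCmd (.arr 6 (.sub numCols (.add (.reg 10) (.lit 1))) (.lit 0)))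

theorem runs_eliminateAllCmd {s : State} {G M : Matrix (Fin d) (Fin d) ℝ}
    {B : ℕ} (h : HasOrder A ε D pos top s) (ho : IsEliminationOrder D.bag pos top)
    (hM : ∀ j k : Fin d, s.real 3 j k = M j k)
    (he : EliminationState D.bag pos G d M)
    (hB : ∀ t, (bagList D t).length ≤ B) (hB1 : 1 ≤ B) (hd : 1 ≤ d) :
    Runs eliminateAllCmd s (20000 * (d * (B * B))) (fun s' =>
      (∀ j k : Fin d, s'.real 3 j k = 0) ∧
      ∀ x, BackSubstitution (D.bag (top x)) pos G x (fun y => s'.real 4 x y) (s'.real 5 x 0)) := by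
  have hBB : B ≤ B * B := Nat.le_mul_self B
  -- Elimination runs backwards: after `k` rounds the positions from `d - k` on are done.
  refine (Runs.forLoop (fun k s' => (∃ M : Matrix (Fin d) (Fin d) ℝ,
      (∀ i j : Fin d, s'.real 3 i j = M i j) ∧ EliminationState D.bag pos G (d - k) M) ∧
    ∀ x, d - k ≤ (pos x : ℕ) → BackSubstitution (D.bag (top x)) pos G x
      (fun y => s'.real 4 x y) (s'.real 5 x 0)) (by simp) (fun _ _ _ h => h)
    (fun s' ha => (h.of_agreeOff ha (by simp) (by simp)).eval_numCols)
    ⟨⟨M, hM, he⟩, fun x hx => absurd (pos x).2 (by omega)⟩ ?_ le_rfl hd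
    (c := 6000 * (B * B)) (c' := 6000 * (B * B) + 20) ?_).mono ?_ ?_
  · rintro k hk s' ha hr ⟨⟨M, hM, he⟩, hbs⟩
    have hS := h.of_agreeOff ha (by simp) (by simp)
    set x := pos.symm ⟨d - (k + 1), by omega⟩ with hx
    have hpx : (pos x : ℕ) = d - (k + 1) := by simp [hx]
    have hpx' : (pos x : ℕ) + 1 = d - k := by omega
    refine (runs_eliminateCmd hS ho (x := x) ?_ ?_ hM (hpx' ▸ he) hB hB1).mono le_rfl ?_
    · intro s'' hb
      have hS' := hS.of_agreeOff hb (by simp) (by simp)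
      have := hS'.order ⟨d - (k + 1), by omega⟩
      simpa [NExp.eval, numCols, hS'.numCols, hb.nat 10 (by simp), hr, hx] using this
    · simp [NExp.cost, numCols, NExp.reg]
    · rintro s'' - ⟨h1, h2, h3⟩
      refine ⟨⟨_, h1, hpx ▸ (hpx'.symm ▸ he).eliminate ho⟩, fun y hy => ?_⟩
      by_cases hyx : y = x
      · exact hyx ▸ h2
      · have hne : (pos y : ℕ) ≠ pos x := fun e => hyx (pos.injective (Fin.ext e))
        obtain ⟨h5, h4⟩ := h3 y hyx
        rw [h5]
        simp only [h4]
        exact hbs y (by omega)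
  · simp [numCols, NExp.cost]
  · calc 3 * d * (6000 * (B * B) + 20) = 18000 * (d * (B * B)) + 60 * (d * 1) := by ring
      _ ≤ 18000 * (d * (B * B)) + 60 * (d * (B * B)) := by
        gcongr
        omega
      _ ≤ _ := by omega
  · rintro s' - ⟨⟨M, hM, he⟩, hbs⟩
    -- No vertex remains, so the support condition forces the zero matrix, and array 3 is ready for
    -- the next step.
    refine ⟨fun j k => ?_, fun x => hbs x (by omega)⟩
    rw [hM]
    by_contra h0
    have := he.supp j k h0
    omega

end RealRAM

namespace RealRAM

variable {n d m : ℕ} {A : Matrix (Fin n) (Fin d) ℝ} {ε : ℝ}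
  {D : TreeDecomposition (columnGraph A) m} {pos : Fin d ≃ Fin d} {top : Fin d → Fin m}

/-! ### Back substitution -/

/-- Compute the row and the column of the inverse matrix at `v`. -/
def backCmd (v : NExp) : Cmd :=
  .seq (.forLoop 11 (topLen v)
    (.seq (.setReal 9 (.lit 0) (.lit 0) (.ofNat (.lit 0)))
    (.seq (.forLoop 12 (topLen v) (.setReal 9 (.lit 0) (.lit 0) (.add (.reg 9)
      (.mul (.arr 4 v (topElem v 12)) (.arr 6 (topElem v 12) (topElem v 11))))))
    (.seq (.setReal 6 v (topElem v 11) (.sub (.ofNat (.lit 0)) (.reg 9)))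
    (.setReal 6 (topElem v 11) v (.sub (.ofNat (.lit 0)) (.reg 9)))))))
  -- The diagonal entry comes last because it uses the column of `v` just computed. The loop above
  -- also writes meaningless values at `v` itself and at later vertices of the bag; the former is
  -- replaced here, the latter when those vertices are treated.
  (.seq (.setReal 9 (.lit 0) (.lit 0) (.ofNat (.lit 0)))
  (.seq (.forLoop 12 (topLen v) (.setReal 9 (.lit 0) (.lit 0) (.add (.reg 9)
    (.mul (.arr 4 v (topElem v 12)) (.arr 6 (topElem v 12) v)))))
  (.setReal 6 v v (.sub (.div (.ofNat (.lit 1)) (.arr 5 v (.lit 0))) (.reg 9)))))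

@[simp] theorem natWrites_backCmd (v : NExp) : (backCmd v).natWrites = [11, 12, 12, 11, 12, 12] :=
  rfl

@[simp] theorem realWrites_backCmd (v : NExp) :
    (backCmd v).realWrites = [9, 9, 6, 6, 9, 9, 6] := rfl

/-- The multipliers of `x` are nonzero only at earlier vertices of its bag. For an earlier `y` in
the same bag, every entry of the inverse that enters the sum belongs to two earlier vertices sharing
this bag, so it is known by `hZ`. Conversely, every earlier vertex sharing some bag with `x` lies in
this one, so no required entry is missed. -/
theorem runs_backCmd {s : State} {v : NExp} {x : Fin d} {G : Matrix (Fin d) (Fin d) ℝ}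
    {B : ℕ} (h : HasOrder A ε D pos top s) (ho : IsEliminationOrder D.bag pos top)
    (hv : ∀ s', AgreeOff [11, 12] [6, 9] s s' → v.eval s' = x) (hvc : v.cost ≤ 12)
    (hbs : BackSubstitution (D.bag (top x)) pos G x (fun y => s.real 4 x y) (s.real 5 x 0))
    (hG : ∀ j k, G j k = G k j)
    (hZ : ∀ j k, pos j < pos x → pos k < pos x → (∃ t, j ∈ D.bag t ∧ k ∈ D.bag t) →
      s.real 6 j k = G j k)
    (hB : ∀ t, (bagList D t).length ≤ B) (hB1 : 1 ≤ B) :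
    Runs (backCmd v) s (6000 * (B * B)) (fun s' => ∀ j k, pos j ≤ pos x → pos k ≤ pos x →
      (∃ t, j ∈ D.bag t ∧ k ∈ D.bag t) → s'.real 6 j k = G j k) := by
  have hBB : B ≤ B * B := Nat.le_mul_self B
  have hord : ∀ s', AgreeOff [11, 12] [6, 9] s s' → HasOrder A ε D pos top s' :=
    fun s' ha => h.of_agreeOff ha (by simp) (by simp)
  have hlt : ∀ j, pos j < pos x → j ≠ x := by
    rintro j hj rfl
    exact lt_irrefl _ hj
  refine (Runs.seq (Runs.forEach (bagList D (top x)) (nodup_bagList _ _)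
      (fun S s' => (∀ j k : Fin d, j ≠ x → k ≠ x → s'.real 6 j k = s.real 6 j k) ∧
        ∀ k ∈ S, pos k < pos x → s'.real 6 x k = G x k ∧ s'.real 6 k x = G k x) (by simp)
      (fun _ _ _ h => h) ?_ (by simp) ?_ (c := 10 + (3 * B * 120 + 200))
      (c' := 3 * B * 120 + 250) (hB _) hB1 ?_) (c' := 10 + (3 * B * 120 + 200)) ?_).mono
        ?_ fun _ _ h => h
  · intro s' ha
    have hab : AgreeOff [11, 12] [6, 9] s s' := ha.mono (by simp) (by simp)
    exact (hord _ hab).eval_topLen (hv _ hab)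
  · rintro k hk S hS s₁ ha hr ⟨hZ₁, hrow⟩
    have ha₁ : AgreeOff [11, 12] [6, 9] s s₁ := ha.mono (by simp) (by simp)
    have hyb : (bagList D (top x))[k] ∈ D.bag (top x) := mem_bagList.1 (List.getElem_mem hk)
    have helem : ∀ s', AgreeOff [12] [6, 9] s₁ s' →
        (topElem v 11).eval s' = (bagList D (top x))[k] := by
      intro s' hb
      have hab := ha₁.trans (hb.mono (by simp) (by simp))
      exact (hord _ hab).eval_topElem (hv _ hab) (by rw [hb.nat 11 (by simp), hr]) hk
    set y := (bagList D (top x))[k] with hy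
    refine Runs.seq ((Runs.setReal (Q := fun s' => s'.real 9 0 0 = 0)
      (by simp [State.setReal_real_same, RExp.eval])).mono (c' := 10) (by simp [NExp.cost, RExp.cost])
      fun _ _ h => h) ?_
    intro s₂ ha₂ hacc
    have hab₂ := ha₁.trans (ha₂.mono (by simp) (by simp))
    refine Runs.seq (Runs.sumLoop (bagList D (top x)) (nodup_bagList _ _)
      (fun z => s.real 4 x z * s₁.real 6 z y) ?_ ?_ (hB _) hB1 (c' := 120) ?_) ?_
    · intro s' hb
      have hab := hab₂.trans (hb.mono (by simp) (by simp))
      exact (hord _ hab).eval_topLen (hv _ hab)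
    · intro l hl s' hb hr'
      have hab := hab₂.trans (hb.mono (by simp) (by simp))
      simp only [RExp.eval, hv _ hab, (hord _ hab).eval_topElem (hv _ hab) hr' hl,
        helem s' ((ha₂.mono (by simp) (by simp)).trans (hb.mono (by simp) (by simp))),
        hab.real 4 (by simp), hb.real 6 (by simp), ha₂.real 6 (by simp)]
    · simp only [topLen, topElem, NExp.cost, RExp.cost, NExp.reg]
      omega
    · intro s₃ ha₃ hsum
      have hab₃ := hab₂.trans (ha₃.mono (by simp) (by simp))
      have h13 : AgreeOff [12] [6, 9] s₁ s₃ :=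
        (ha₂.mono (by simp) (by simp)).trans (ha₃.mono (by simp) (by simp))
      rw [hacc, zero_add, toFinset_bagList] at hsum
      have h63 : s₃.real 6 = s₁.real 6 := by rw [ha₃.real 6 (by simp), ha₂.real 6 (by simp)]
      have hval : pos y < pos x → - s₃.real 9 0 0 = G x y := by
        intro hyx
        rw [hbs.off y hyx, hsum]
        congr 1
        refine Finset.sum_congr rfl fun z hz => ?_
        by_cases hc : s.real 4 x z = 0
        · simp [hc]
        · have hzx := hbs.lt z hz hc
          rw [hZ₁ z y (hlt z hzx) (hlt y hyx), hZ z y hzx hyx ⟨_, hz, hyb⟩]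
      refine (Runs.seq (Runs.setReal
        (Q := fun s' => s' = s₃.setReal 6 x y (- s₃.real 9 0 0)) ?_)
        (c' := (topElem v 11).cost + v.cost + 6 + 1) ?_).mono (c' := 200) ?_ fun _ _ h => h
      · simp [hv _ hab₃, helem _ h13, RExp.eval]
      · rintro s₄ ha₄ rfl
        have hab₄ := hab₃.trans (ha₄.mono (by simp) (by simp))
        refine Runs.setReal ?_
        rw [hv _ hab₄, helem _ (h13.trans (ha₄.mono (by simp) (by simp)))]
        have hval' : RExp.eval (s₃.setReal 6 x y (- s₃.real 9 0 0))
            (.sub (.ofNat (.lit 0)) (.reg 9)) = - s₃.real 9 0 0 := by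
          simp [RExp.eval, State.setReal_real_of_ne]
        have h6 : ∀ j k : Fin d, ((s₃.setReal 6 x y (- s₃.real 9 0 0)).setReal 6 y x
            (RExp.eval (s₃.setReal 6 x y (- s₃.real 9 0 0))
              (.sub (.ofNat (.lit 0)) (.reg 9)))).real 6 j k =
            if j = y ∧ k = x ∨ j = x ∧ k = y then - s₃.real 9 0 0 else s₁.real 6 j k := by
          intro j k
          rw [hval', State.setReal_real_same, State.setReal_real_same, h63]
          simp only [Fin.val_inj]
          split_ifs <;> first | rfl | (exfalso; tauto)
        constructor
        · intro j k hj hk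
          rw [h6, if_neg (by tauto), hZ₁ j k hj hk]
        · intro k hk hkx
          rw [h6, h6]
          by_cases hky : k = y
          · rw [if_pos (by tauto), if_pos (by tauto), hG k x, hky, hval (hky ▸ hkx)]
            exact ⟨rfl, rfl⟩
          · have hkx' := hlt k hkx
            rw [if_neg (by tauto), if_neg (by tauto)]
            exact hrow k (Finset.mem_of_mem_insert_of_ne hk hky) hkx
      · simp only [topElem, NExp.cost, RExp.cost, NExp.reg, RExp.reg]
        omega
  · simp only [topLen, NExp.cost]
    omega
  · rintro s₁ ha ⟨hZ₁, hrow⟩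
    have ha₁ : AgreeOff [11, 12] [6, 9] s s₁ := ha.mono (by simp) (by simp)
    rw [toFinset_bagList] at hrow
    refine Runs.seq ((Runs.setReal (Q := fun s' => s'.real 9 0 0 = 0)
      (by simp [State.setReal_real_same, RExp.eval])).mono (c' := 10) (by simp [NExp.cost, RExp.cost])
      fun _ _ h => h) ?_
    intro s₂ ha₂ hacc
    have hab₂ := ha₁.trans (ha₂.mono (by simp) (by simp))
    refine Runs.seq (Runs.sumLoop (bagList D (top x)) (nodup_bagList _ _)
      (fun z => s.real 4 x z * s₁.real 6 z x) ?_ ?_ (hB _) hB1 (c' := 120) ?_) ?_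
    · intro s' hb
      have hab := hab₂.trans (hb.mono (by simp) (by simp))
      exact (hord _ hab).eval_topLen (hv _ hab)
    · intro l hl s' hb hr'
      have hab := hab₂.trans (hb.mono (by simp) (by simp))
      simp only [RExp.eval, hv _ hab, (hord _ hab).eval_topElem (hv _ hab) hr' hl,
        hab.real 4 (by simp), hb.real 6 (by simp), ha₂.real 6 (by simp)]
    · simp only [topLen, topElem, NExp.cost, RExp.cost, NExp.reg]
      omega
    · intro s₃ ha₃ hsum
      have hab₃ := hab₂.trans (ha₃.mono (by simp) (by simp))
      rw [hacc, zero_add, toFinset_bagList] at hsum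
      have h63 : s₃.real 6 = s₁.real 6 := by rw [ha₃.real 6 (by simp), ha₂.real 6 (by simp)]
      have hval : 1 / s.real 5 x 0 - s₃.real 9 0 0 = G x x := by
        rw [hbs.diag, hsum]
        congr 1
        refine Finset.sum_congr rfl fun z hz => ?_
        by_cases hc : s.real 4 x z = 0
        · simp [hc]
        · rw [(hrow z hz (hbs.lt z hz hc)).2]
      refine (Runs.setReal ?_).mono (c' := 200) ?_ fun _ _ h => h
      · intro j k hj hk hjk
        rw [hv _ hab₃, State.setReal_real_same]
        simp only [RExp.eval, NExp.eval_lit, hv _ hab₃, hab₃.real 5 (by simp), Fin.val_inj, h63,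
          RExp.eval_reg, Nat.cast_one, hval]
        have hne : ∀ j, pos j ≤ pos x → j ≠ x → pos j < pos x := fun j hj hjx =>
          lt_of_le_of_ne hj fun e => hjx (pos.injective e)
        obtain ⟨t, hjt, hkt⟩ := hjk
        by_cases hjx : j = x
        · by_cases hkx : k = x
          · simp [hjx, hkx]
          · rw [if_neg (by tauto), hjx]
            rw [hjx] at hjt
            exact (hrow k (ho.mem t k x hkt hjt hk) (hne k hk hkx)).1
        · rw [if_neg (by tauto)]
          by_cases hkx : k = x
          · rw [hkx] at hkt ⊢
            exact (hrow j (ho.mem t j x hjt hkt hj) (hne j hj hjx)).2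
          · rw [hZ₁ j k hjx hkx, hZ j k (hne j hj hjx) (hne k hk hkx) ⟨t, hjt, hkt⟩]
      · simp only [NExp.cost, RExp.cost, RExp.reg]
        omega
  · have h1 : 3 * B * (3 * B * 120 + 250) = 1080 * (B * B) + 750 * B := by ring
    omega

/-- Compute the inverse matrix at all pairs of vertices sharing a bag. -/
def backAllCmd : Cmd :=
  .forLoop 10 numCols (backCmd (.arr 6 (.reg 10) (.lit 0)))

theorem runs_backAllCmd {s : State} {G : Matrix (Fin d) (Fin d) ℝ}
    {B : ℕ} (h : HasOrder A ε D pos top s) (ho : IsEliminationOrder D.bag pos top)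
    (hbs : ∀ x, BackSubstitution (D.bag (top x)) pos G x (fun y => s.real 4 x y) (s.real 5 x 0))
    (hG : ∀ j k, G j k = G k j)
    (hB : ∀ t, (bagList D t).length ≤ B) (hB1 : 1 ≤ B) (hd : 1 ≤ d) :
    Runs backAllCmd s (20000 * (d * (B * B))) (fun s' => ∀ j k,
      (∃ t, j ∈ D.bag t ∧ k ∈ D.bag t) → s'.real 6 j k = G j k) := by
  have hBB : B ≤ B * B := Nat.le_mul_self B
  refine (Runs.forLoop (fun i s' => ∀ j k, (pos j : ℕ) < i → (pos k : ℕ) < i →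
      (∃ t, j ∈ D.bag t ∧ k ∈ D.bag t) → s'.real 6 j k = G j k) (by simp) (fun _ _ _ h => h)
    (fun s' ha => (h.of_agreeOff ha (by simp) (by simp)).eval_numCols) (by simp) ?_ le_rfl hd
    (c := 6000 * (B * B)) (c' := 6000 * (B * B) + 20) ?_).mono ?_ ?_
  · intro i hi s' ha hr hZ
    have hS := h.of_agreeOff ha (by simp) (by simp)
    set x := pos.symm ⟨i, hi⟩ with hx
    have hpx : pos x = ⟨i, hi⟩ := by simp [hx]
    refine (runs_backCmd hS ho (x := x) (G := G) ?_ ?_ ?_ hG ?_ hB hB1).mono le_rfl ?_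
    · intro s'' hb
      have hS' := hS.of_agreeOff hb (by simp) (by simp)
      have := hS'.order ⟨i, hi⟩
      simpa [NExp.eval, hb.nat 10 (by simp), hr, hx] using this
    · simp [NExp.cost, NExp.reg]
    · rw [ha.real 4 (by simp), ha.real 5 (by simp)]
      exact hbs x
    · intro j k hj hk
      rw [hpx, Fin.lt_def] at hj hk
      exact hZ j k hj hk
    · intro s'' _ hs'' j k hj hk
      refine hs'' j k ?_ ?_ <;> rw [hpx, Fin.le_def] <;> simp only <;> omega
  · simp [numCols, NExp.cost]
  · calc 3 * d * (6000 * (B * B) + 20) = 18000 * (d * (B * B)) + 60 * (d * 1) := by ring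
      _ ≤ 18000 * (d * (B * B)) + 60 * (d * (B * B)) := by
        gcongr
        omega
      _ ≤ _ := by omega
  · intro s' _ hs' j k
    exact hs' j k (pos j).2 (pos k).2

/-! ### Leverage scores -/

/-- Replace the weights by the leverage scores. -/
def scoreCmd : Cmd :=
  .forLoop 10 numRows
    (.seq (.setReal 9 (.lit 0) (.lit 0) (.ofNat (.lit 0)))
    (.seq (.forLoop 11 rowLen (.forLoop 12 rowLen (.setReal 9 (.lit 0) (.lit 0) (.add (.reg 9)
      (.mul (.mul (rowVal 11) (rowVal 12)) (.arr 6 (rowCol 11) (rowCol 12)))))))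
    (.setReal 7 (.reg 10) (.lit 0) (.mul (.arr 7 (.reg 10) (.lit 0)) (.reg 9)))))

/-- By `hA`, only entries of the inverse at pairs sharing a bag are read. Overwriting the weights in
place is harmless: the inverse is already stored, and the old weight of a row is used for that row
only. -/
theorem runs_scoreCmd {s : State} {w : Fin n → ℝ} {G : Matrix (Fin d) (Fin d) ℝ} {B : ℕ}
    (h : HasInput A ε D s) (hw : ∀ i : Fin n, s.real 7 i 0 = w i)
    (hZ : ∀ j k, (∃ t, j ∈ D.bag t ∧ k ∈ D.bag t) → s.real 6 j k = G j k)
    (hA : ∀ i j k, A i j ≠ 0 → A i k ≠ 0 → ∃ t, j ∈ D.bag t ∧ k ∈ D.bag t)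
    (hB : ∀ i, (rowSupport A i).length ≤ B) (hB1 : 1 ≤ B) (hn : 1 ≤ n) :
    Runs scoreCmd s (6000 * (n * (B * B)))
      (fun s' => ∀ i : Fin n, s'.real 7 i 0 = w i * ∑ j, ∑ k, A i j * A i k * G j k) := by
  have hBB : B ≤ B * B := Nat.le_mul_self B
  refine (Runs.forFin (fun S s' => ∀ i : Fin n, s'.real 7 i 0 =
      if i ∈ S then w i * ∑ j, ∑ k, A i j * A i k * G j k else w i)
    (by simp) (fun _ _ _ h => h)
    (fun s' ha => (h.of_agreeOff ha (by simp) (by simp)).eval_numRows) (by simpa using hw)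
    (c := 10 + (3 * B * (3 * B * 100 + 100) + 30))
    (c' := 1800 * (B * B)) ?_ hn ?_).mono ?_ ?_
  · intro i S hS s₁ ha hi hw₁
    have hin : ∀ s', AgreeOff [10, 11, 12] [7, 9] s s' → HasInput A ε D s' :=
      fun s' ha => h.of_agreeOff ha (by simp) (by simp)
    have ha₁ : AgreeOff [10, 11, 12] [7, 9] s s₁ := ha.mono (by simp) (by simp)
    refine Runs.seq ((Runs.setReal (Q := fun s' => s'.real 9 0 0 = 0)
      (by simp [State.setReal_real_same, RExp.eval])).mono (c' := 10) (by simp [NExp.cost, RExp.cost])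
      fun _ _ h => h) ?_
    intro s₂ ha₂ hacc
    have hab₂ := ha₁.trans (ha₂.mono (by simp) (by simp))
    have hi₂ : s₂.nat 10 0 0 = i := by rw [ha₂.nat 10 (by simp), hi]
    refine Runs.seq (Runs.forEach (rowSupport A i) (nodup_rowSupport A i)
      (fun S s' => s'.real 9 0 0 = ∑ j ∈ S, ∑ k ∈ (rowSupport A i).toFinset,
        A i j * A i k * G j k) (by simp) (fun _ _ _ h => h) ?_ (by simpa using hacc) ?_
      (c := 3 * B * 100) (c' := 3 * B * 100 + 100) (hB i) hB1 ?_) ?_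
    · intro s' hb
      exact (hin _ (hab₂.trans (hb.mono (by simp) (by simp)))).eval_rowLen
        (by rw [hb.nat 10 (by simp), hi₂])
    · intro k hk S' hS' s₃ ha₃ hr hacc₃
      have hab₃ := hab₂.trans (ha₃.mono (by simp) (by simp))
      have hi₃ : s₃.nat 10 0 0 = i := by rw [ha₃.nat 10 (by simp), hi₂]
      refine (Runs.sumLoop (rowSupport A i) (nodup_rowSupport A i)
        (fun z => A i (rowSupport A i)[k] * A i z * G (rowSupport A i)[k] z) ?_ ?_ (hB i) hB1
        ?_).mono le_rfl ?_
      · intro s' hb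
        exact (hin _ (hab₃.trans (hb.mono (by simp) (by simp)))).eval_rowLen
          (by rw [hb.nat 10 (by simp), hi₃])
      · intro l hl s' hb hr'
        have hab := hab₃.trans (hb.mono (by simp) (by simp))
        have hI := hin _ hab
        have hi' : s'.nat 10 0 0 = i := by rw [hb.nat 10 (by simp), hi₃]
        have hk' : s'.nat 11 0 0 = k := by rw [hb.nat 11 (by simp), hr]
        simp only [RExp.eval, hI.eval_rowVal hi' hk' hk, hI.eval_rowVal hi' hr' hl,
          hI.eval_rowCol hi' hk' hk, hI.eval_rowCol hi' hr' hl, hab.real 6 (by simp)]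
        rw [hZ _ _ (hA i _ _ (mem_rowSupport.1 (List.getElem_mem hk))
          (mem_rowSupport.1 (List.getElem_mem hl)))]
      · simp [rowCol, rowVal, rowLen, NExp.cost, RExp.cost, NExp.reg]
      · intro s' _ hs'
        rw [hs', hacc₃, Finset.sum_insert hS', add_comm]
    · simp only [rowLen, NExp.cost, NExp.reg]
      omega
    · intro s₃ ha₃ hsum
      have hab₃ := hab₂.trans (ha₃.mono (by simp) (by simp))
      have hi₃ : s₃.nat 10 0 0 = i := by rw [ha₃.nat 10 (by simp), hi₂]
      have hfull : ∑ j ∈ (rowSupport A i).toFinset, ∑ k ∈ (rowSupport A i).toFinset,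
          A i j * A i k * G j k = ∑ j, ∑ k, A i j * A i k * G j k := by
        rw [Finset.sum_subset (Finset.subset_univ _)]
        · refine Finset.sum_congr rfl fun j _ => Finset.sum_subset (Finset.subset_univ _) ?_
          intro k _ hk
          have : A i k = 0 := by simpa [mem_rowSupport] using hk
          simp [this]
        · intro j _ hj
          have : A i j = 0 := by simpa [mem_rowSupport] using hj
          simp [this]
      refine (Runs.setReal ?_).mono (c' := 30) ?_ fun _ _ h => h
      · intro i'
        have h7 : s₃.real 7 = s₁.real 7 := by rw [ha₃.real 7 (by simp), ha₂.real 7 (by simp)]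
        rw [State.setReal_real_same]
        simp only [RExp.eval, NExp.eval_reg, NExp.eval_lit, RExp.eval_reg, hi₃, h7, hw₁, hsum,
          hfull, hS, if_false, Fin.val_inj, and_true, Finset.mem_insert]
        by_cases hii : i' = i
        · simp [hii]
        · simp [hii]
      · simp [NExp.cost, RExp.cost, NExp.reg, RExp.reg]
  · have h1 : 3 * B * (3 * B * 100 + 100) = 900 * (B * B) + 300 * B := by ring
    simp only [numRows, NExp.cost]
    omega
  · calc 3 * n * (1800 * (B * B)) = 5400 * (n * (B * B)) := by ring
      _ ≤ _ := Nat.mul_le_mul_right _ (by norm_num)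
  · simp

end RealRAM

namespace RealRAM

variable {n d m : ℕ} {A : Matrix (Fin n) (Fin d) ℝ} {ε : ℝ}
  {D : TreeDecomposition (columnGraph A) m} {pos : Fin d ≃ Fin d} {top : Fin d → Fin m}

/-! ### The fixed-point step -/

/-- One step of the fixed-point iteration. -/
def stepCmd : Cmd := .seq gramCmd (.seq eliminateAllCmd (.seq backAllCmd scoreCmd))

theorem natWrites_stepCmd : stepCmd.natWrites ⊆ [10, 11, 12] := by
  simp [stepCmd, gramCmd, eliminateAllCmd, backAllCmd, scoreCmd]

theorem realWrites_stepCmd : stepCmd.realWrites ⊆ [3, 4, 5, 6, 7, 9] := by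
  simp [stepCmd, gramCmd, eliminateAllCmd, backAllCmd, scoreCmd]

theorem exists_bag_of_row (D : TreeDecomposition (columnGraph A) m) (i : Fin n) (j k : Fin d)
    (hj : A i j ≠ 0) (hk : A i k ≠ 0) : ∃ t, j ∈ D.bag t ∧ k ∈ D.bag t := by
  by_cases hjk : j = k
  · obtain ⟨t, ht⟩ := D.cover j
    exact ⟨t, ht, hjk ▸ ht⟩
  · exact D.edge j k ⟨hjk, i, hj, hk⟩

/-- The support of a row is a clique of the column graph, hence contained in one bag. -/
theorem length_rowSupport_le (ho : IsEliminationOrder D.bag pos top) (i : Fin n) :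
    (rowSupport A i).length ≤ D.width + 1 := by
  rw [← List.toFinset_card_of_nodup (nodup_rowSupport A i)]
  rcases (rowSupport A i).toFinset.eq_empty_or_nonempty with h0 | hne
  · simp [h0]
  · obtain ⟨t, ht⟩ := ho.exists_subset_bag hne fun u hu v hv => by
      rw [List.mem_toFinset, mem_rowSupport] at hu hv
      exact exists_bag_of_row D i u v hu hv
    exact (Finset.card_le_card ht).trans (D.card_bag_le t)

theorem runs_stepCmd {s : State} {B k : ℕ} (h : HasOrder A ε D pos top s)
    (ho : IsEliminationOrder D.bag pos top) (hA : A.rank = d)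
    (hd : 1 ≤ d) (hw : ∀ i : Fin n, s.real 7 i 0 = fixedPointIterate A k i)
    (hM : ∀ j k : Fin d, s.real 3 j k = 0) (hB : B = D.width + 1) :
    Runs stepCmd s (60000 * (n * (B * B))) (fun s' =>
      (∀ i : Fin n, s'.real 7 i 0 = fixedPointIterate A (k + 1) i) ∧
      ∀ j k : Fin d, s'.real 3 j k = 0) := by
  have hdn : d ≤ n := rank_le_of_rank_eq hA
  have hBrow : ∀ i, (rowSupport A i).length ≤ B := hB ▸ length_rowSupport_le ho
  have hBbag : ∀ t, (bagList D t).length ≤ B := fun t => by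
    rw [length_bagList, hB]
    exact D.card_bag_le t
  have hB1 : 1 ≤ B := by omega
  have hP := posDef_gram_iterate hA hd k
  have hdet := hP.det_pos.ne'.isUnit
  refine (Runs.seq (runs_gramCmd h.toHasInput hw hM hBrow hB1 (by omega))
    (c' := 20000 * (d * (B * B)) + (20000 * (d * (B * B)) + 6000 * (n * (B * B)))) ?_).mono
      ?_ fun _ _ h => h
  · intro s₁ ha₁ hM₁
    set M := Aᵀ * Matrix.diagonal (fixedPointIterate A k) * A with hMdef
    have h₁ := h.of_agreeOff ha₁ (by simp [gramCmd]) (by simp [gramCmd])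
    have hG : ∀ j k, M⁻¹ j k = M⁻¹ k j := hP.inv.posSemidef.apply_comm
    refine Runs.seq (runs_eliminateAllCmd (G := M⁻¹) h₁ ho hM₁ ?_ hBbag hB1 hd) ?_
    · refine ⟨hP.posSemidef, fun k _ j => ?_, fun j k hjk => ?_, fun j k _ => (pos j).2⟩
      · rw [Matrix.mul_nonsing_inv _ hdet, Matrix.one_apply]
      · rw [hMdef, gram_apply] at hjk
        obtain ⟨i, -, hi⟩ := Finset.exists_ne_zero_of_sum_ne_zero hjk
        exact exists_bag_of_row D i j k (right_ne_zero_of_mul (left_ne_zero_of_mul hi))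
          (right_ne_zero_of_mul hi)
    · rintro s₂ ha₂ ⟨hM₂, hbs⟩
      have h₂ := h₁.of_agreeOff ha₂ (by simp [eliminateAllCmd]) (by simp [eliminateAllCmd])
      refine Runs.seq (runs_backAllCmd (G := M⁻¹) h₂ ho hbs hG hBbag hB1 hd) ?_
      intro s₃ ha₃ hZ
      have h₃ := h₂.of_agreeOff ha₃ (by simp [backAllCmd]) (by simp [backAllCmd])
      refine (runs_scoreCmd (w := fixedPointIterate A k) h₃.toHasInput ?_ hZ (exists_bag_of_row D)
        hBrow hB1 (by omega)).mono le_rfl ?_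
      · intro i
        rw [ha₃.real 7 (by simp [backAllCmd]), ha₂.real 7 (by simp [eliminateAllCmd]),
          ha₁.real 7 (by simp [gramCmd]), hw]
      · intro s₄ ha₄ hw₄
        refine ⟨fun i => ?_, fun j k => ?_⟩
        · rw [hw₄, fixedPointIterate,
            leverageScore_sqrt_mul_eq_sum (fixedPointIterate_nonneg hA hd k)]
        · rw [ha₄.real 3 (by simp [scoreCmd]), ha₃.real 3 (by simp [backAllCmd]), hM₂]
  · have : d * (B * B) ≤ n * (B * B) := Nat.mul_le_mul_right _ hdn
    omega

/-! ### Computing the elimination order -/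

/-- The current element of the current bag. -/
def bagElem : NExp := .arr 5 (.reg 10) (.reg 11)

/-- List the vertices in the order in which they occur in the bags. -/
def orderCmd : Cmd :=
  .forLoop 10 numBags (.forLoop 11 (.arr 4 (.reg 10) (.lit 0))
    (.ite (.natLt (.arr 8 bagElem (.lit 0)) (.lit 1))
      (.seq (.setNat 8 bagElem (.lit 0) (.lit 1))
      (.seq (.setNat 7 bagElem (.lit 0) (.reg 10))
      (.seq (.setNat 6 (.reg 9) (.lit 0) bagElem)
      (.setNat 9 (.lit 0) (.lit 0) (.add (.reg 9) (.lit 1))))))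
      .nop))

/-- The memory contains the list `l` of vertices, sorted by their highest bags. -/
structure HasList (top : Fin d → Fin m) (l : List (Fin d)) (s : State) : Prop where
  nodup : l.Nodup
  sorted : l.Pairwise fun u v => top u ≤ top v
  length : s.nat 9 0 0 = l.length
  get : ∀ (i : ℕ) (h : i < l.length), s.nat 6 i 0 = l[i]
  seen : ∀ v : Fin d, s.nat 8 v 0 = if v ∈ l then 1 else 0
  topBag : ∀ v ∈ l, s.nat 7 v 0 = top v

theorem HasList.setNat {l : List (Fin d)} {s : State} (h : HasList top l s) {r : ℕ} (hr : 10 ≤ r)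
    (v : ℕ) : HasList top l (s.setNat r 0 0 v) where
  nodup := h.nodup
  sorted := h.sorted
  length := by rw [State.setNat_nat_of_ne _ _ _ _ (by omega), h.length]
  get i hi := by rw [State.setNat_nat_of_ne _ _ _ _ (by omega), h.get i hi]
  seen v := by rw [State.setNat_nat_of_ne _ _ _ _ (by omega), h.seen v]
  topBag v hv := by rw [State.setNat_nat_of_ne _ _ _ _ (by omega), h.topBag v hv]

theorem HasList.append {l : List (Fin d)} {s : State} (h : HasList top l s) {v : Fin d}
    (hv : v ∉ l) (hle : ∀ u ∈ l, top u ≤ top v) :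
    HasList top (l ++ [v]) ((((s.setNat 8 v 0 1).setNat 7 v 0 (top v)).setNat 6 l.length 0 v).setNat
      9 0 0 (l.length + 1)) where
  nodup := by
    rw [List.nodup_append]
    refine ⟨h.nodup, by simp, ?_⟩
    rintro a ha b hb rfl
    exact hv (List.mem_singleton.1 hb ▸ ha)
  sorted := by
    rw [List.pairwise_append]
    exact ⟨h.sorted, by simp, by simpa using hle⟩
  length := by simp [State.setNat_nat_same]
  get i hi := by
    rw [State.setNat_nat_of_ne _ _ _ _ (by norm_num), State.setNat_nat_same]
    by_cases hil : i = l.length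
    · simp [hil]
    · have hi' : i < l.length := by
        rw [List.length_append, List.length_singleton] at hi
        omega
      rw [if_neg (by tauto), State.setNat_nat_of_ne _ _ _ _ (by norm_num),
        State.setNat_nat_of_ne _ _ _ _ (by norm_num), h.get i hi', List.getElem_append_left hi']
  seen u := by
    rw [State.setNat_nat_of_ne _ _ _ _ (by norm_num), State.setNat_nat_of_ne _ _ _ _ (by norm_num),
      State.setNat_nat_of_ne _ _ _ _ (by norm_num), State.setNat_nat_same, h.seen]
    by_cases huv : u = v
    · simp [huv]
    · simp [huv, Fin.val_inj]
  topBag u hu := by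
    rw [State.setNat_nat_of_ne _ _ _ _ (by norm_num), State.setNat_nat_of_ne _ _ _ _ (by norm_num),
      State.setNat_nat_same]
    by_cases huv : u = v
    · simp [huv]
    · rw [if_neg (by simpa [Fin.val_inj] using huv), State.setNat_nat_of_ne _ _ _ _ (by norm_num)]
      exact h.topBag u (by simpa [huv] using hu)

/-- Bags are scanned by increasing number, so a vertex is first met in its smallest, that is
highest, bag. Hence the list comes out sorted by `top` without any sorting. -/
theorem runs_orderCmd_aux {s : State} {B : ℕ} (h : HasInput A ε D s) (h0 : HasList top [] s)
    (htop : ∀ v, v ∈ D.bag (top v)) (hmin : ∀ v t, v ∈ D.bag t → top v ≤ t)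
    (hB : ∀ t, (bagList D t).length ≤ B) (hB1 : 1 ≤ B) (hm : 1 ≤ m) :
    Runs orderCmd s (6000 * (m * (B * B)))
      (fun s' => ∃ l, HasList top l s' ∧ ∀ v, v ∈ l) := by
  have hBB : B ≤ B * B := Nat.le_mul_self B
  refine (Runs.forLoop (fun t s' => ∃ l, HasList top l s' ∧ ∀ v, v ∈ l ↔ (top v : ℕ) < t) (by simp)
    (fun _ _ v ⟨l, hl, hl'⟩ => ⟨l, hl.setNat (by norm_num) v, hl'⟩)
    (fun s' ha => (h.of_agreeOff ha (by simp) (by simp)).eval_numBags) ⟨[], h0, by simp⟩ ?_ le_rfl hm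
    (c := 3 * B * 200) (c' := 1000 * B) ?_).mono ?_ ?_
  · rintro t ht s₁ ha₁ hr ⟨l, hl, hlt⟩
    have h₁ := h.of_agreeOff ha₁ (by simp) (by simp)
    refine (Runs.forEach (bagList D ⟨t, ht⟩) (nodup_bagList _ _) (fun S s' => S ⊆ D.bag ⟨t, ht⟩ ∧
      ∃ l, HasList top l s' ∧ ∀ v, v ∈ l ↔ (top v : ℕ) < t ∨ v ∈ S) (by simp)
      (fun _ _ v ⟨hS, l, hl, hl'⟩ => ⟨hS, l, hl.setNat (by norm_num) v, hl'⟩) ?_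
      ⟨by simp, l, hl, by simpa using hlt⟩ ?_ (c := 100) (hB _) hB1 ?_).mono le_rfl ?_
    · intro s' hb
      have := (h₁.of_agreeOff hb (by simp) (by simp)).bagLen ⟨t, ht⟩
      simpa [NExp.eval, hb.nat 10 (by simp), hr] using this
    · rintro k hk S hS s₂ ha₂ hr₂ ⟨hSb, l, hl, hlm⟩
      have h₂ := h₁.of_agreeOff ha₂ (by simp) (by simp)
      have hr₂' : s₂.nat 10 0 0 = t := by rw [ha₂.nat 10 (by simp), hr]
      have hmem : (bagList D ⟨t, ht⟩)[k] ∈ D.bag ⟨t, ht⟩ := mem_bagList.1 (List.getElem_mem hk)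
      have helem : s₂.nat 5 t k = (bagList D ⟨t, ht⟩)[k] := h₂.bagElem ⟨t, ht⟩ hk
      set v := (bagList D ⟨t, ht⟩)[k] with hv
      have hins : insert v S ⊆ D.bag ⟨t, ht⟩ := Finset.insert_subset hmem hSb
      refine (Runs.ite (c := 60) ?_ ?_).mono ?_ fun _ _ h => h
      · intro hb
        have hvl : v ∉ l := by
          intro hvl
          simp [BExp.holds, NExp.eval, bagElem, hr₂', hr₂, helem, hl.seen, hvl] at hb
        -- Had `v` a smaller bag, the invariant would have put it into the list already.
        have htv : top v = ⟨t, ht⟩ := by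
          refine le_antisymm (hmin v _ hmem) (Fin.le_def.2 ?_)
          by_contra hlt
          exact hvl ((hlm v).2 (Or.inl (by simpa using hlt)))
        have happ := hl.append hvl fun u hu => by
          rw [htv]
          rcases (hlm u).1 hu with hu | hu
          · exact Fin.le_def.2 hu.le
          · exact hmin u _ (hSb hu)
        refine (Runs.seq (Runs.setNat (Q := fun s' => s' = s₂.setNat 8 v 0 1) ?_) ?_
          (c' := 40)).mono ?_ fun _ _ h => h
        · simp [NExp.eval, bagElem, hr₂', hr₂, helem]
        · rintro _ - rfl
          refine (Runs.seq (Runs.setNat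
            (Q := fun s' => s' = (s₂.setNat 8 v 0 1).setNat 7 v 0 (top v)) ?_) ?_
            (c' := 25)).mono ?_ fun _ _ h => h
          · simp [NExp.eval, bagElem, hr₂', hr₂, helem, State.setNat_nat_of_ne, htv]
          · rintro _ - rfl
            refine (Runs.seq (Runs.setNat (Q := fun s' => s' =
              ((s₂.setNat 8 v 0 1).setNat 7 v 0 (top v)).setNat 6 l.length 0 v) ?_) ?_
              (c' := 10)).mono ?_ fun _ _ h => h
            · simp [NExp.eval, bagElem, hr₂', hr₂, helem, State.setNat_nat_of_ne, hl.length]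
            · rintro _ - rfl
              refine (Runs.setNat ⟨hins, l ++ [v], ?_, fun u => ?_⟩).mono ?_ fun _ _ h => h
              · simp [NExp.cost, NExp.reg]
              · simpa [NExp.eval, State.setNat_nat_of_ne, hl.length] using happ
              · rw [List.mem_append, List.mem_singleton, hlm, Finset.mem_insert]
                tauto
            · simp [NExp.cost, NExp.reg, bagElem]
          · simp [NExp.cost, NExp.reg, bagElem]
        · simp [NExp.cost, NExp.reg, bagElem]
      · intro hb
        have hvl : v ∈ l := by
          by_contra hvl
          simp [BExp.holds, NExp.eval, bagElem, hr₂', hr₂, helem, hl.seen, hvl] at hb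
        refine (Runs.nop ⟨hins, l, hl, fun u => ?_⟩).mono (by norm_num) fun _ _ h => h
        rw [hlm, Finset.mem_insert]
        constructor
        · tauto
        · rintro (hu | rfl | hu)
          · exact Or.inl hu
          · exact (hlm _).1 hvl
          · exact Or.inr hu
      · simp [BExp.cost, NExp.cost, NExp.reg, bagElem]
    · simp [NExp.cost, NExp.reg]
    · rintro s₂ - ⟨-, l, hl, hlm⟩
      refine ⟨l, hl, fun v => ?_⟩
      rw [hlm, toFinset_bagList, Nat.lt_succ_iff_lt_or_eq]
      constructor
      · rintro (hv | hv)
        · exact Or.inl hv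
        · exact Nat.lt_or_eq_of_le (Fin.le_def.1 (hmin v _ hv))
      · rintro (hv | hv)
        · exact Or.inl hv
        · have : top v = ⟨t, ht⟩ := Fin.ext hv
          exact Or.inr (this ▸ htop v)
  · simp only [numBags, NExp.cost]
    omega
  · calc 3 * m * (1000 * B) = 3000 * (m * B) := by ring
      _ ≤ 3000 * (m * (B * B)) := by gcongr
      _ ≤ _ := by omega
  · rintro s' - ⟨l, hl, hlm⟩
    exact ⟨l, hl, fun v => (hlm v).2 (top v).2⟩

/-- If `u` precedes `v` in the list, then the highest bag of `u` is not numbered after that of `v`;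
this is the hypothesis of `mem_bag_of_le`. Zero initial memory supplies the empty list and the
cleared flags. -/
theorem runs_orderCmd {s : State} {B : ℕ} (h : HasInput A ε D s) (hD : D.RootFirst)
    (hs : ∀ a, 6 ≤ a → ∀ i j, s.nat a i j = 0)
    (hB : ∀ t, (bagList D t).length ≤ B) (hB1 : 1 ≤ B) :
    Runs orderCmd s (6000 * (m * (B * B))) (fun s' => ∃ (pos : Fin d ≃ Fin d)
      (top : Fin d → Fin m), IsEliminationOrder D.bag pos top ∧ HasOrder A ε D pos top s') := by
  have hm : 1 ≤ m := by
    obtain ⟨t⟩ := D.isTree.connected.nonempty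
    exact t.pos
  have hex : ∀ v, ∃ t, v ∈ D.bag t ∧ ∀ t', v ∈ D.bag t' → t ≤ t' := by
    intro v
    obtain ⟨t, ht⟩ := D.cover v
    have hne : (Finset.univ.filter fun t => v ∈ D.bag t).Nonempty := ⟨t, by simpa using ht⟩
    refine ⟨_, (Finset.mem_filter.1 (Finset.min'_mem _ hne)).2, fun t' ht' => ?_⟩
    exact Finset.min'_le _ _ (by simpa using ht')
  choose top htop hmin using hex
  refine (runs_orderCmd_aux h ⟨by simp, by simp, by simp [hs], by simp, by simp [hs], by simp⟩
    htop hmin hB hB1 hm).mono le_rfl ?_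
  rintro s' ha ⟨l, hl, hmem⟩
  have hlen : l.length = d := by
    rw [← List.toFinset_card_of_nodup hl.nodup, Finset.eq_univ_of_forall (s := l.toFinset)
      (by simpa using hmem), Finset.card_univ, Fintype.card_fin]
  let e : Fin d ≃ Fin d := (finCongr hlen.symm).trans (hl.nodup.getEquivOfForallMemList l hmem)
  have he : ∀ (i : ℕ) (hi : i < d), e ⟨i, hi⟩ = l[i] := fun i hi => rfl
  refine ⟨e.symm, top, ⟨fun t u v hu hv huv => ?_, D.cover⟩,
    ⟨h.of_agreeOff ha (by simp [orderCmd]) (by simp [orderCmd]), fun i => ?_,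
      fun v => hl.topBag v (hmem v)⟩⟩
  · refine D.mem_bag_of_le hD (htop u) (htop v) (hmin v) ?_ hu hv
    have h1 : u = l[(e.symm u : ℕ)] := by rw [← he _ (e.symm u).2]; simp
    have h2 : v = l[(e.symm v : ℕ)] := by rw [← he _ (e.symm v).2]; simp
    rcases huv.eq_or_lt with huv | huv
    · rw [e.symm.injective huv]
    · have := List.pairwise_iff_getElem.1 hl.sorted (e.symm u) (e.symm v) (by simp [hlen])
        (by simp [hlen]) huv
      rwa [← h1, ← h2] at this
  · rw [Equiv.symm_symm, hl.get i (by simp [hlen]), ← he i i.2]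

end RealRAM

namespace RealRAM

variable {n d m : ℕ} {A : Matrix (Fin n) (Fin d) ℝ} {ε : ℝ}
  {D : TreeDecomposition (columnGraph A) m} {pos : Fin d ≃ Fin d} {top : Fin d → Fin m}

/-! ### The whole algorithm -/

/-- Replace each of the first `n` entries of an array by the value of `e`. -/
def mapCmd (a : ℕ) (e : RExp) : Cmd := .forLoop 10 numRows (.setReal a (.reg 10) (.lit 0) e)

theorem runs_mapCmd {s : State} {a : ℕ} {e : RExp} (h : HasInput A ε D s) (f : Fin n → ℝ)
    (ha : 2 ≤ a) (hn : 1 ≤ n) (hc : e.cost ≤ 50)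
    (he : ∀ (i : Fin n) s', AgreeOff [10] [a] s s' → s'.nat 10 0 0 = i →
      s'.real a i 0 = s.real a i 0 → e.eval s' = f i) :
    Runs (mapCmd a e) s (300 * n) (fun s' => ∀ i : Fin n, s'.real a i 0 = f i) := by
  refine (Runs.forFin (fun S s' => ∀ i : Fin n, s'.real a i 0 =
    if i ∈ S then f i else s.real a i 0) (by simp) (fun _ _ _ h => h)
    (fun s' hb => (h.of_agreeOff hb (by simp) (by simpa using ha)).eval_numRows) (by simp) ?_ hn
    (c := 60) (c' := 100) ?_).mono (by omega) (by simp)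
  · intro i S hS s' hb hi hs'
    refine (Runs.setReal ?_).mono ?_ fun _ _ h => h
    · intro j
      rw [State.setReal_real_same]
      simp only [NExp.eval_reg, NExp.eval_lit, hi, Fin.val_inj, and_true, Finset.mem_insert]
      rw [he i s' (hb.mono (by simp) (by simp)) hi (by rw [hs', if_neg hS]), hs']
      by_cases hji : j = i
      · simp [hji]
      · simp [hji]
    · simp only [NExp.cost, NExp.reg]
      omega
  · simp [numRows, NExp.cost]

/-- Compute an upper bound for `2 ε⁻¹ log (n / d)` by iterated square roots. -/
def lengthCmd : Cmd :=
  .seq (.setReal 9 (.lit 0) (.lit 0) (.div (.ofNat numRows) (.ofNat numCols)))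
  (.seq (.setReal 10 (.lit 0) (.lit 0) (.ofNat (.lit 1)))
  (.seq (.forLoop 10 numRows
    (.seq (.setReal 9 (.lit 0) (.lit 0) (.sqrt (.reg 9)))
    (.setReal 10 (.lit 0) (.lit 0) (.add (.reg 10) (.reg 10)))))
  (.setReal 8 (.lit 0) (.lit 0)
    (.div (.mul (.add (.reg 10) (.reg 10)) (.sub (.reg 9) (.ofNat (.lit 1)))) (.reg 0)))))

/-- Taking as many roots as there are rows keeps the cost linear in n, and it is enough for a good
approximation of the logarithm since n/d ≤ n. -/
theorem runs_lengthCmd {s : State} (h : HasInput A ε D s) (hd : 1 ≤ d) (hdn : d ≤ n) :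
    Runs lengthCmd s (300 * n) (fun s' => ∃ y : ℝ, 1 ≤ y ∧ y ^ 2 ^ n = (n : ℝ) / d ∧
      s'.real 8 0 0 = 2 * (2 ^ n * (y - 1)) / ε) := by
  have hd' : (0 : ℝ) < d := by exact_mod_cast hd
  have hx : (1 : ℝ) ≤ n / d := by
    rw [one_le_div hd']
    exact_mod_cast hdn
  refine (Runs.seq (Runs.setReal (Q := fun s' => s'.real 9 0 0 = (n : ℝ) / d) ?_)
    (c' := 10 + (3 * n * 60 + 30)) ?_).mono ?_ fun _ _ h => h
  · simp [State.setReal_real_same, RExp.eval, h.eval_numRows, h.eval_numCols]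
  · intro s₁ ha₁ h9
    refine Runs.seq ((Runs.setReal
      (Q := fun s' => s'.real 9 0 0 = (n : ℝ) / d ∧ s'.real 10 0 0 = 1) ?_).mono ?_
        fun _ _ h => h) ?_
    · simp [State.setReal_real_same, State.setReal_real_of_ne, RExp.eval, h9]
    · simp [NExp.cost, RExp.cost]
    · rintro s₂ ha₂ ⟨h9, h10⟩
      have h₂ := (h.of_agreeOff ha₁ (by simp) (by simp)).of_agreeOff ha₂ (by simp) (by simp)
      refine Runs.seq (Runs.forLoop (fun k s' => ∃ y : ℝ, 1 ≤ y ∧ y ^ 2 ^ k = (n : ℝ) / d ∧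
          s'.real 9 0 0 = y ∧ s'.real 10 0 0 = 2 ^ k) (by simp) (fun _ _ _ h => h)
        (fun s' ha => (h₂.of_agreeOff ha (by simp) (by simp)).eval_numRows)
        ⟨_, hx, by simp, h9, by simpa using h10⟩ ?_ le_rfl (by omega) (c := 40) ?_) ?_
      · rintro k - s' - - ⟨y, hy, hyx, h9, h10⟩
        refine (Runs.seq (Runs.setReal
          (Q := fun s' => s'.real 9 0 0 = √y ∧ s'.real 10 0 0 = 2 ^ k) ?_)
          (c' := 20) ?_).mono ?_ fun _ _ h => h
        · simp [State.setReal_real_same, State.setReal_real_of_ne, RExp.eval, h9, h10]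
        · rintro s'' - ⟨h9, h10⟩
          refine (Runs.setReal ⟨√y, ?_, ?_, ?_, ?_⟩).mono ?_ fun _ _ h => h
          · simp [NExp.cost, RExp.cost, RExp.reg]
          · exact Real.one_le_sqrt.2 hy
          · rw [pow_succ', pow_mul, Real.sq_sqrt (by linarith), hyx]
          · simp [State.setReal_real_of_ne, h9]
          · simp only [NExp.eval_lit, State.setReal_real_same, RExp.eval, RExp.eval_reg, h10,
              and_self, if_true]
            ring
        · simp [NExp.cost, RExp.cost, RExp.reg]
      · simp [numRows, NExp.cost]
      · rintro s₃ ha₃ ⟨y, hy, hyx, h9, h10⟩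
        have h₃ := h₂.of_agreeOff ha₃ (by simp) (by simp)
        refine (Runs.setReal ⟨y, hy, hyx, ?_⟩).mono ?_ fun _ _ h => h
        · simp [NExp.cost, RExp.cost, RExp.reg]
        · simp only [NExp.eval_lit, State.setReal_real_same, RExp.eval, RExp.eval_reg, h9, h10,
            and_self, if_true, h₃.eps, Nat.cast_one]
          ring
  · simp only [NExp.cost, RExp.cost, numRows, numCols]
    omega

/-- The test whether the number of iterations is too small. -/
def moreIterations : BExp :=
  .neg (.conj (.neg (.natLt (.reg 13) (.lit 1))) (.neg (.realLt (.ofNat (.reg 13)) (.reg 8))))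

/-- Add up the weights and make one step, until the number of iterations is large enough. -/
def iterateCmd : Cmd :=
  .loop moreIterations
    (.seq (mapCmd 2 (.add (.arr 2 (.reg 10) (.lit 0)) (.arr 7 (.reg 10) (.lit 0))))
    (.seq (.setNat 13 (.lit 0) (.lit 0) (.add (.reg 13) (.lit 1))) stepCmd))

/-- The machine cannot round up, but comparing the counter with the real number `L` stops at the
least positive integer that is at least `L`. Weights are added before each step, so after k rounds
the sum contains exactly the iterates below k. -/
theorem runs_iterateCmd {s : State} {B : ℕ} {L : ℝ} (h : HasOrder A ε D pos top s)
    (ho : IsEliminationOrder D.bag pos top) (hA : A.rank = d) (hd : 1 ≤ d)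
    (hw : ∀ i : Fin n, s.real 7 i 0 = fixedPointIterate A 0 i)
    (hsum : ∀ i : Fin n, s.real 2 i 0 = 0) (hM : ∀ j k : Fin d, s.real 3 j k = 0)
    (hT : s.nat 13 0 0 = 0) (hL : s.real 8 0 0 = L) (hB : B = D.width + 1) :
    Runs iterateCmd s ((max 1 ⌈L⌉₊ + 1) * (61000 * (n * (B * B)))) (fun s' => HasOrder A ε D pos top s' ∧
      s'.nat 13 0 0 = max 1 ⌈L⌉₊ ∧ ∀ i : Fin n, s'.real 2 i 0 =
        ∑ k ∈ Finset.range (max 1 ⌈L⌉₊), fixedPointIterate A k i) := by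
  have hdn : d ≤ n := rank_le_of_rank_eq hA
  have hBB : B ≤ B * B := Nat.le_mul_self B
  have hnB : n * 1 ≤ n * (B * B) := Nat.mul_le_mul_left _ (by omega)
  refine (Runs.loop (fun k s' => HasOrder A ε D pos top s' ∧ s'.nat 13 0 0 = k ∧
      s'.real 8 0 0 = L ∧ (∀ i : Fin n, s'.real 7 i 0 = fixedPointIterate A k i) ∧
      (∀ i : Fin n, s'.real 2 i 0 = ∑ j ∈ Finset.range k, fixedPointIterate A j i) ∧
      ∀ j k : Fin d, s'.real 3 j k = 0) (max 1 ⌈L⌉₊) ?_ ?_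
    ⟨h, hT, hL, hw, by simpa using hsum, hM⟩
    (c := 300 * n + (10 + 60000 * (n * (B * B))))).mono ?_ ?_
  · rintro k - s' ⟨-, hk, hL, -⟩
    simp only [moreIterations, BExp.holds, NExp.eval_reg, NExp.eval_lit, RExp.eval, RExp.eval_reg,
      hk, hL, lt_max_iff, Nat.lt_ceil]
    tauto
  · rintro k - s₁ ⟨h₁, hk₁, hL₁, hw₁, hs₁, hM₁⟩
    refine Runs.seq (runs_mapCmd h₁.toHasInput
      (fun i => ∑ j ∈ Finset.range (k + 1), fixedPointIterate A j i) le_rfl (by omega)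
      (by simp [RExp.cost, NExp.cost, NExp.reg]) ?_) ?_
    · intro i s' ha hi h2
      simp only [RExp.eval, NExp.eval_reg, NExp.eval_lit, hi, h2, hs₁, ha.real 7 (by simp), hw₁,
        Finset.sum_range_succ]
    · intro s₂ ha₂ hs₂
      have hb₂ : AgreeOff [10] [2] s₁ s₂ := ha₂.mono (by simp [mapCmd]) (by simp [mapCmd])
      refine Runs.seq ((Runs.setNat (Q := fun s' => s' = s₂.setNat 13 0 0 (k + 1)) ?_).mono ?_
        fun _ _ h => h) ?_
      · simp [NExp.eval, hb₂.nat 13 (by simp), hk₁]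
      · simp [NExp.cost, NExp.reg]
      · rintro s₃ ha₃ rfl
        have h₃ := (h₁.of_agreeOff hb₂ (by simp) (by simp)).of_agreeOff ha₃ (by simp) (by simp)
        refine (runs_stepCmd (k := k) h₃ ho hA hd ?_ ?_ hB).mono le_rfl ?_
        · intro i
          rw [State.setNat_real, hb₂.real 7 (by simp), hw₁]
        · intro i j
          rw [State.setNat_real, hb₂.real 3 (by simp), hM₁]
        · rintro s₄ ha₄ ⟨hw₄, hM₄⟩
          have hb₄ := ha₄.mono natWrites_stepCmd realWrites_stepCmd
          refine ⟨h₃.of_agreeOff hb₄ (by simp) (by simp), ?_, ?_, hw₄, ?_, hM₄⟩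
          · rw [hb₄.nat 13 (by simp)]
            simp [State.setNat_nat_same]
          · rw [hb₄.real 8 (by simp), State.setNat_real, hb₂.real 8 (by simp), hL₁]
          · intro i
            rw [hb₄.real 2 (by simp), State.setNat_real, hs₂]
  · have hb : moreIterations.cost = 17 := by
      simp [moreIterations, BExp.cost, RExp.cost, NExp.cost, NExp.reg, RExp.reg]
    rw [hb, Nat.add_mul (max 1 ⌈L⌉₊) 1]
    -- The additional unit in the number of rounds pays for the final failing test.
    exact Nat.add_le_add (Nat.mul_le_mul_left _ (by omega)) (by omega)
  · rintro s' - ⟨h', hk, -, -, hs', -⟩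
    exact ⟨h', hk, hs'⟩

/-- The algorithm. -/
def johnCmd : Cmd :=
  .seq orderCmd (.seq lengthCmd (.seq (mapCmd 7 (.div (.ofNat numCols) (.ofNat numRows)))
    (.seq iterateCmd (mapCmd 2 (.div (.arr 2 (.reg 10) (.lit 0)) (.ofNat (.reg 13)))))))

theorem runs_johnCmd (hA : A.rank = d) (hd : 1 ≤ d) (hm : m ≤ n) (hD : D.RootFirst) {B : ℕ}
    (hB : B = D.width + 1) :
    ∃ y : ℝ, 1 ≤ y ∧ y ^ 2 ^ n = (n : ℝ) / d ∧
      Runs johnCmd (inputState A ε D)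
        ((max 1 ⌈2 * (2 ^ n * (y - 1)) / ε⌉₊ + 1) * (70000 * (n * (B * B))))
        (fun s' => ∀ i : Fin n, s'.real 2 i 0 =
          averageIterate A (max 1 ⌈2 * (2 ^ n * (y - 1)) / ε⌉₊) i) := by
  have hdn : d ≤ n := rank_le_of_rank_eq hA
  have hBbag : ∀ t, (bagList D t).length ≤ B := fun t => by
    rw [length_bagList, hB]
    exact D.card_bag_le t
  have h0 : HasInput A ε D (inputState A ε D) := ⟨fun _ _ => rfl, fun _ _ => rfl⟩
  have hnat : ∀ a, 6 ≤ a → ∀ i j, (inputState A ε D).nat a i j = 0 := by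
    intro a ha i j
    obtain ⟨b, rfl⟩ := Nat.exists_eq_add_of_le' ha
    rfl
  have hreal : ∀ a, 2 ≤ a → ∀ i j, (inputState A ε D).real a i j = 0 := by
    intro a ha i j
    obtain ⟨b, rfl⟩ := Nat.exists_eq_add_of_le' ha
    rfl
  obtain ⟨s₁, t₁, he₁, ht₁, pos, top, ho, h₁⟩ := runs_orderCmd h0 hD hnat hBbag (by omega)
  have ha₁ := he₁.agreeOff.mono (V := [6, 7, 8, 9, 10, 11]) (V' := []) (by simp [orderCmd])
    (by simp [orderCmd])
  obtain ⟨s₂, t₂, he₂, ht₂, y, hy, hyx, hL⟩ := runs_lengthCmd h₁.toHasInput hd hdn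
  have ha₂ := he₂.agreeOff.mono (V := [10]) (V' := [8, 9, 10]) (by simp [lengthCmd])
    (by simp [lengthCmd])
  have h₂ := h₁.of_agreeOff ha₂ (by simp) (by simp)
  refine ⟨y, hy, hyx, ?_⟩
  set T := max 1 ⌈2 * (2 ^ n * (y - 1)) / ε⌉₊ with hT
  obtain ⟨s₃, t₃, he₃, ht₃, hw⟩ := runs_mapCmd (a := 7)
    (e := .div (.ofNat numCols) (.ofNat numRows)) h₂.toHasInput
    (fixedPointIterate A 0) (by norm_num) (by omega)
    (by simp [RExp.cost, NExp.cost, numCols, numRows]) (by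
      intro i s' ha _ _
      have h' := h₂.of_agreeOff ha (by simp) (by simp)
      simp [RExp.eval, h'.eval_numCols, h'.eval_numRows, fixedPointIterate])
  have ha₃ := he₃.agreeOff.mono (V := [10]) (V' := [7]) (by simp [mapCmd]) (by simp [mapCmd])
  have h₃ := h₂.of_agreeOff ha₃ (by simp) (by simp)
  obtain ⟨s₄, t₄, he₄, ht₄, h₄, hT₄, hs₄⟩ := runs_iterateCmd (s := s₃)
    (L := 2 * (2 ^ n * (y - 1)) / ε) h₃ ho hA hd hw
    (fun i => by
      rw [ha₃.real 2 (by simp), ha₂.real 2 (by simp), ha₁.real 2 (by simp), hreal 2 le_rfl])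
    (fun i j => by
      rw [ha₃.real 3 (by simp), ha₂.real 3 (by simp), ha₁.real 3 (by simp),
        hreal 3 (by norm_num)])
    (by rw [ha₃.nat 13 (by simp), ha₂.nat 13 (by simp), ha₁.nat 13 (by simp),
      hnat 13 (by norm_num)])
    (by rw [ha₃.real 8 (by simp), hL]) hB
  rw [← hT] at ht₄ hT₄ hs₄
  obtain ⟨s₅, t₅, he₅, ht₅, hs₅⟩ := runs_mapCmd (a := 2)
    (e := .div (.arr 2 (.reg 10) (.lit 0)) (.ofNat (.reg 13))) h₄.toHasInput (averageIterate A T) le_rfl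
    (by omega) (by simp [RExp.cost, NExp.cost, NExp.reg]) (by
      intro i s' ha hi h2
      simp [RExp.eval, hi, h2, hs₄, ha.nat 13 (by simp), hT₄, averageIterate])
  refine ⟨s₅, _, .seq he₁ (.seq he₂ (.seq he₃ (.seq he₄ he₅))), ?_, hs₅⟩
  have h1 : m * (B * B) ≤ n * (B * B) := Nat.mul_le_mul_right _ hm
  have h2 : n * 1 ≤ n * (B * B) := Nat.mul_le_mul_left _
    (Nat.mul_pos (by omega) (by omega))
  -- The phases outside the iteration cost at most 6000mB² + 900n, which is below 9000nB² because m
  -- ≤ n.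
  have h3 : 1 * (9000 * (n * (B * B))) ≤ (T + 1) * (9000 * (n * (B * B))) :=
    Nat.mul_le_mul_right _ (by omega)
  have h4 : (T + 1) * (70000 * (n * (B * B))) =
      (T + 1) * (61000 * (n * (B * B))) + (T + 1) * (9000 * (n * (B * B))) := by ring
  omega

end RealRAM

/-! ### The main theorem -/

theorem theorem1p2 :
    ∃ (p : RealRAM.Cmd) (C : ℝ), 0 < C ∧
      ∀ (n d : ℕ) (A : Matrix (Fin n) (Fin d) ℝ) (ε : ℝ) (τ m : ℕ)
        (D : TreeDecomposition (columnGraph A) m),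
        0 < d → A.rank = d → 0 < ε → ε < 1 → matrixTreewidth A = τ →
        D.width = τ → D.RootFirst → m ≤ n →
        ∃ (s : RealRAM.State) (t T : ℕ) (u : Fin n → ℝ),
          RealRAM.Exec p (inputState A ε D) s t ∧
          (t : ℝ) ≤ C * (ε⁻¹ * Real.log ((n : ℝ) / d) ⊔ 1) * (n * ((τ : ℝ) ⊔ 1) ^ 2) ∧
          (∀ i : Fin n, s.real 2 i 0 = u i) ∧
          1 ≤ T ∧
          ε⁻¹ * Real.log ((n : ℝ) / d) ≤ T ∧
          (T : ℝ) ≤ C * (ε⁻¹ * Real.log ((n : ℝ) / d) ⊔ 1) ∧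
          u = averageIterate A T ∧
          (Aᵀ * Matrix.diagonal u * A).PosDef ∧
          (1 / √(1 + ε)) • ellipsoid (Aᵀ * Matrix.diagonal u * A) ⊆ polytope A ∧
          polytope A ⊆ √(d : ℝ) • ellipsoid (Aᵀ * Matrix.diagonal u * A) := by
  -- The time is at most 70000(T + 1)n(τ + 1)². Here T + 1 is at most 6 times the maximum of X and
  -- 1, and τ + 1 at most twice the maximum of τ and 1, so the constant needed is 70000 · 6 · 4 =
  -- 1680000.
  refine ⟨RealRAM.johnCmd, 2000000, by norm_num, ?_⟩
  intro n d A ε τ m D hd hA hε hε1 _ hτ hD hm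
  have hdn : d ≤ n := rank_le_of_rank_eq hA
  have hn : 0 < n := hd.trans_le hdn
  have hd' : (0 : ℝ) < d := Nat.cast_pos.2 hd
  obtain ⟨y, hy, hyx, s, t, hexec, ht, hs⟩ := RealRAM.runs_johnCmd (ε := ε) hA hd hm hD rfl
  set L := 2 * (2 ^ n * (y - 1)) / ε with hL
  set T := max 1 ⌈L⌉₊ with hT
  set X := ε⁻¹ * Real.log ((n : ℝ) / d) with hX
  have hlog : 0 ≤ Real.log ((n : ℝ) / d) :=
    Real.log_nonneg ((one_le_div hd').2 (by exact_mod_cast hdn))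
  have hX0 : 0 ≤ X := by positivity
  -- The computed bound satisfies 2X ≤ L ≤ 4X: the lower estimate gives the accuracy, the upper one
  -- the running time.
  have hL1 : 2 * X ≤ L := by
    have := log_le_two_pow_mul_sub_one hy hyx
    rw [hL, hX, le_div_iff₀ hε]
    calc 2 * (ε⁻¹ * Real.log ((n : ℝ) / d)) * ε = 2 * Real.log ((n : ℝ) / d) := by field_simp
      _ ≤ _ := by linarith
  have hL2 : L ≤ 4 * X := by
    have := two_pow_mul_sub_one_le_log hy hyx
      (div_le_self (Nat.cast_nonneg n) (by exact_mod_cast hd))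
    rw [hL, hX, div_le_iff₀ hε]
    calc 2 * (2 ^ n * (y - 1)) ≤ 4 * Real.log ((n : ℝ) / d) := by linarith
      _ = _ := by field_simp
  have hT1 : 1 ≤ T := le_max_left _ _
  have hLT : L ≤ T := (Nat.le_ceil L).trans (by exact_mod_cast le_max_right _ _)
  have hTle : (T : ℝ) ≤ 5 * (X ⊔ 1) := by
    have h1 : X ≤ X ⊔ 1 := le_sup_left
    have h2 : 1 ≤ X ⊔ 1 := le_sup_right
    have h3 : (⌈L⌉₊ : ℝ) < L + 1 := Nat.ceil_lt_add_one (by linarith)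
    rw [hT, Nat.cast_max, Nat.cast_one]
    exact max_le (by linarith) (by linarith)
  refine ⟨s, t, T, averageIterate A T, hexec, ?_, hs, hT1, by linarith, ?_, rfl,
    posDef_gram_average hA hd hT1, smul_ellipsoid_subset hA hd hn hε hε1 hT1 (by linarith),
    polytope_subset hA hd hn hT1⟩
  · have hB : ((D.width + 1 : ℕ) : ℝ) ≤ 2 * ((τ : ℝ) ⊔ 1) := by
      have h1 : (τ : ℝ) ≤ (τ : ℝ) ⊔ 1 := le_sup_left
      have h2 : (1 : ℝ) ≤ (τ : ℝ) ⊔ 1 := le_sup_right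
      rw [hτ]
      push_cast
      linarith
    have h2 : (1 : ℝ) ≤ X ⊔ 1 := le_sup_right
    calc (t : ℝ) ≤ ((T + 1) * (70000 * (n * ((D.width + 1) * (D.width + 1)))) : ℕ) := by
          exact_mod_cast ht
      _ = (T + 1) * (70000 * (n * (((D.width + 1 : ℕ) : ℝ) * ((D.width + 1 : ℕ) : ℝ)))) := by
          push_cast
          ring
      _ ≤ (6 * (X ⊔ 1)) *
          (70000 * (n * ((2 * ((τ : ℝ) ⊔ 1)) * (2 * ((τ : ℝ) ⊔ 1))))) := by
          gcongr
          linarith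
      _ = 1680000 * ((X ⊔ 1) * (n * ((τ : ℝ) ⊔ 1) ^ 2)) := by ring
      _ ≤ 2000000 * ((X ⊔ 1) * (n * ((τ : ℝ) ⊔ 1) ^ 2)) := by
          gcongr
          norm_num
      _ = _ := by ring
  · have h2 : (1 : ℝ) ≤ X ⊔ 1 := le_sup_right
    linarith
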